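/- **Setting.** Let $\mathcal H_2=\mathcal H_2^{p\times m}(\mathbb C^+)$ be the Hardy space of analytic functions $F:\mathbb C^+\to\mathbb C^{p\times m}$ on the open right half-plane with $\sup_{\xi>0}\int_{-\infty}^{\infty}\|F(\xi+\imath\omega)\|_F^2\,d\omega<\infty$, with inner product $\langle F,G\rangle=\frac1{2\pi}\int_{-\infty}^\infty\operatorname{tr}\bigl(F(\imath\omega)^*G(\imath\omega)\bigr)\,d\omega$ (boundary values). For $\mathbb K\in\{\mathbb R,\mathbb C\}$ let $\Sigma=\Sigma^-_{r,m,p}(\mathbb K)\subset\mathcal H_2$ be the set of functions $\hat C(sI-\hat A)^{-1}\hat B$ with $\hat A\in\mathbb K^{r\times r}$ Hurwitz, $\hat B\in\mathbb K^{r\times m}$, $\hat C\in\mathbb K^{p\times r}$ and $(\hat A,\hat B,\hat C)$ minimal (of least possible order). For $\hat H\in\Sigma$, the tangent space $T_{\hat H}\Sigma\subset\mathcal H_2$ is the set of velocities at $\hat H$ of smooth curves in $\Sigma$ through $\hat H$; orthogonality is with respect to $\operatorname{Re}\langle\cdot,\cdot\rangle$. For $H\in\mathcal H_2$ let $f(G)=\|H-G\|_{\mathcal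 H_2}^2$, and let $\operatorname{grad}f(\hat H)$ be the orthogonal projection onto $T_{\hat H}\Sigma$ of the Wirtinger gradient $\nabla_{\overline G}f(\hat H)$, defined by $f(\hat H+\Delta)=f(\hat H)+2\operatorname{Re}\langle\nabla_{\overline G}f(\hat H),\Delta\rangle+o(\|\Delta\|)$ (so $\nabla_{\overline G}f(\hat H)=\hat H-H$). The orthographic retraction is $R_{\hat H}(v)=\hat H+v+w$, where $w$ is the one and only one smallest element of the orthogonal complement of $T_{\hat H}\Sigma$ with $\hat H+v+w\in\Sigma$; it is defined at $v\in T_{\hat H}\Sigma$ when such a $w$ exists. **Theorem.** Let $H(s)=C(sE-A)^{-1}B$ and $\hat H_k(s)=\hat C_k(s\hat E_k-\hat A_k)^{-1}\hat B_k$ be real systems of orders $n$ and $r$, with $E,\hat E_k$ invertible, $E^{-1}A,\hat E_k^{-1}\hat A_k$ Hurwitz, and $\hat H_k\in\Sigma$. Then the Sylvester and Lyapunov equations $$\begin{aligned} A\tilde P_k\hat E_k^{T}+E\tilde P_k\hat A_k^{T}+B\hat B_k^{T}&=0, & \hat A_k\hat P_k\hat E_k^{T}+\hat E_k\hat P_k\hat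 A_k^{T}+\hat B_k\hat B_k^{T}&=0,\\ A^{T}\tilde Q_k\hat E_k+E^{T}\tilde Q_k\hat A_k+C^{T}\hat C_k&=0, & \hat A_k^{T}\hat Q_k\hat E_k+\hat E_k^{T}\hat Q_k\hat A_k+\hat C_k^{T}\hat C_k&=0 \end{aligned}$$ have unique real solutions $\tilde P_k,\tilde Q_k\in\mathbb R^{n\times r}$, $\hat P_k,\hat Q_k\in\mathbb R^{r\times r}$, and $\hat P_k,\hat Q_k$ are invertible. For $\alpha_k\in\mathbb R$ put $$\begin{aligned} \hat E_{k+1}&=\hat E_k-\alpha_k\bigl(\hat E_k-\hat Q_k^{-1}\tilde Q_k^{T}E\tilde P_k\hat P_k^{-1}\bigr), & \hat A_{k+1}&=\hat A_k-\alpha_k\bigl(\hat A_k-\hat Q_k^{-1}\tilde Q_k^{T}A\tilde P_k\hat P_k^{-1}\bigr),\\ \hat B_{k+1}&=\hat B_k-\alpha_k\bigl(\hat B_k-\hat Q_k^{-1}\tilde Q_k^{T}B\bigr), & \hat C_{k+1}&=\hat C_k-\alpha_k\bigl(\hat C_k-C\tilde P_k\hat P_k^{-1}\bigr). \end{aligned}$$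 The pencil $s\hat E_{k+1}-\hat A_{k+1}$ is regular (that is, $\det(s\hat E_{k+1}-\hat A_{k+1})\not\equiv0$) for all but at most $r$ values of $\alpha_k$. For every $\alpha_k>0$ for which this pencil is regular and the iterate $\hat H_{k+1}=R_{\hat H_k}\bigl(-\alpha_k\operatorname{grad}f(\hat H_k)\bigr)$ is defined, $(\hat E_{k+1},\hat A_{k+1},\hat B_{k+1},\hat C_{k+1})$ is a state-space realization of it: $\hat E_{k+1}$ is invertible, $\hat E_{k+1}^{-1}\hat A_{k+1}$ is Hurwitz, and $\hat H_{k+1}(s)=\hat C_{k+1}(s\hat E_{k+1}-\hat A_{k+1})^{-1}\hat B_{k+1}$. -/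

import Mathlib

open MeasureTheory Filter Topology
open scoped ENNReal NNReal

noncomputable section

namespace H2Red

/-! ### The Hardy space `H₂` of the open right half-plane -/

/-- `ℂ^{p×m}` with the Frobenius inner product `tr (X* Y)`. -/
abbrev Val (p m : ℕ) : Type := EuclideanSpace ℂ (Fin p × Fin m)

/-- A matrix, regarded as an element of `ℂ^{p×m}` with the Frobenius inner product. -/
def toVal {p m : ℕ} (M : Matrix (Fin p) (Fin m) ℂ) : Val p m :=
  WithLp.toLp 2 fun ij => M ij.1 ij.2

/-- The measure `dω / 2π` on the imaginary axis `{iω : ω ∈ ℝ}`. -/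
def axisMeasure : Measure ℝ := ENNReal.ofReal (1 / (2 * Real.pi)) • volume

/-- `F`, restricted to the open right half-plane, is an analytic function with
`sup_{ξ > 0} ∫ ‖F(ξ + iω)‖² dω < ∞`, and `u` is its boundary function on the imaginary axis
(which exists almost everywhere). Values of `F` outside the open right half-plane play no role. -/
def IsHardyExtension {p m : ℕ} (F : ℂ → Val p m) (u : ℝ → Val p m) : Prop :=
  DifferentiableOn ℂ F {s : ℂ | 0 < s.re} ∧
  (∃ K : ℝ≥0, ∀ ξ : ℝ, 0 < ξ → ∫⁻ ω : ℝ, ‖F (ξ + ω * Complex.I)‖ₑ ^ 2 ≤ K) ∧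
  (∀ᵐ ω : ℝ, Tendsto (fun ξ : ℝ => F (ξ + ω * Complex.I)) (𝓝[>] 0) (𝓝 (u ω)))

theorem axisMeasure_ae {P : ℝ → Prop} (h : ∀ᵐ x ∂axisMeasure, P x) : ∀ᵐ x : ℝ, P x := by
  have h0 : ENNReal.ofReal (1 / (2 * Real.pi)) ≠ 0 := by
    rw [Ne, ENNReal.ofReal_eq_zero, not_le]
    positivity
  unfold axisMeasure at h
  rwa [Measure.ae_ennreal_smul_measure_iff h0] at h

theorem IsHardyExtension.congr {p m : ℕ} {F : ℂ → Val p m} {u v : ℝ → Val p m}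
    (h : IsHardyExtension F u) (huv : u =ᵐ[axisMeasure] v) : IsHardyExtension F v := by
  refine ⟨h.1, h.2.1, ?_⟩
  filter_upwards [h.2.2, axisMeasure_ae huv] with ω h1 h2
  rwa [← h2]

theorem IsHardyExtension.zero {p m : ℕ} :
    IsHardyExtension (0 : ℂ → Val p m) (0 : ℝ → Val p m) := by
  refine ⟨differentiableOn_const 0, ⟨0, fun ξ _ => by simp⟩, ?_⟩
  exact Eventually.of_forall fun ω => tendsto_const_nhds

theorem IsHardyExtension.add {p m : ℕ} {F G : ℂ → Val p m} {u v : ℝ → Val p m}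
    (hF : IsHardyExtension F u) (hG : IsHardyExtension G v) :
    IsHardyExtension (F + G) (u + v) := by
  obtain ⟨hF1, ⟨K, hK⟩, hF3⟩ := hF
  obtain ⟨hG1, ⟨L, hL⟩, hG3⟩ := hG
  refine ⟨hF1.add hG1, ⟨2 * K + 2 * L, fun ξ hξ => ?_⟩, ?_⟩
  · have hmeas : Measurable fun ω : ℝ => ‖F (ξ + ω * Complex.I)‖ₑ ^ 2 := by
      have hc : Continuous fun ω : ℝ => F (ξ + ω * Complex.I) := by
        rw [← continuousOn_univ]
        refine hF1.continuousOn.comp (by fun_prop) fun ω _ => ?_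
        simpa using hξ
      exact (hc.enorm.measurable).pow_const 2
    have hpt : ∀ a b : Val p m, ‖a + b‖ₑ ^ 2 ≤ 2 * ‖a‖ₑ ^ 2 + 2 * ‖b‖ₑ ^ 2 := by
      intro a b
      have h1 : ‖a + b‖₊ ^ 2 ≤ 2 * ‖a‖₊ ^ 2 + 2 * ‖b‖₊ ^ 2 := by
        rw [← NNReal.coe_le_coe]
        push_cast
        have := norm_add_le a b
        nlinarith [norm_nonneg (a + b), sq_nonneg (‖a‖ - ‖b‖), norm_nonneg a, norm_nonneg b]
      simp only [enorm_eq_nnnorm]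
      exact_mod_cast h1
    calc ∫⁻ ω : ℝ, ‖(F + G) (ξ + ω * Complex.I)‖ₑ ^ 2
        ≤ ∫⁻ ω : ℝ, (2 * ‖F (ξ + ω * Complex.I)‖ₑ ^ 2 + 2 * ‖G (ξ + ω * Complex.I)‖ₑ ^ 2) :=
          lintegral_mono fun ω => hpt _ _
      _ = 2 * (∫⁻ ω : ℝ, ‖F (ξ + ω * Complex.I)‖ₑ ^ 2)
          + 2 * ∫⁻ ω : ℝ, ‖G (ξ + ω * Complex.I)‖ₑ ^ 2 := by
          rw [lintegral_add_left (hmeas.const_mul 2), lintegral_const_mul' _ _ (by simp),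
            lintegral_const_mul' _ _ (by simp)]
      _ ≤ ((2 * K + 2 * L : ℝ≥0) : ℝ≥0∞) := by
          push_cast
          gcongr
          · exact hK ξ hξ
          · exact hL ξ hξ
  · filter_upwards [hF3, hG3] with ω h1 h2
    exact h1.add h2

theorem IsHardyExtension.smul {p m : ℕ} {F : ℂ → Val p m} {u : ℝ → Val p m} (c : ℂ)
    (hF : IsHardyExtension F u) : IsHardyExtension (c • F) (c • u) := by
  obtain ⟨hF1, ⟨K, hK⟩, hF3⟩ := hF
  refine ⟨hF1.const_smul c, ⟨‖c‖₊ ^ 2 * K, fun ξ hξ => ?_⟩, ?_⟩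
  · have : ∀ ω : ℝ, ‖(c • F) (ξ + ω * Complex.I)‖ₑ ^ 2
        = ‖c‖ₑ ^ 2 * ‖F (ξ + ω * Complex.I)‖ₑ ^ 2 := fun ω => by
      rw [Pi.smul_apply, enorm_smul, mul_pow]
    simp only [this]
    rw [lintegral_const_mul' _ _ (by simp)]
    push_cast
    rw [enorm_eq_nnnorm]
    gcongr
    exact hK ξ hξ
  · filter_upwards [hF3] with ω h1
    exact h1.const_smul c

/-- The Hardy space `H₂ = H₂^{p×m}(ℂ⁺)`, its elements being identified with their boundary
functions in `L²`; its inner product is `⟨F, G⟩ = (1/2π) ∫ tr (F(iω)* G(iω)) dω`. -/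
def HardySpace (p m : ℕ) : Submodule ℂ (Lp (Val p m) 2 axisMeasure) where
  carrier := {u | ∃ F : ℂ → Val p m, IsHardyExtension F u}
  zero_mem' := ⟨0, IsHardyExtension.zero.congr (Lp.coeFn_zero _ _ _).symm⟩
  add_mem' := by
    rintro u v ⟨F, hF⟩ ⟨G, hG⟩
    exact ⟨F + G, (hF.add hG).congr (Lp.coeFn_add u v).symm⟩
  smul_mem' := by
    rintro c u ⟨F, hF⟩
    exact ⟨c • F, (hF.smul c).congr (Lp.coeFn_smul c u).symm⟩

/-! ### State-space systems -/

/-- All eigenvalues lie in the open left half-plane. -/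
def Hurwitz {r : ℕ} (M : Matrix (Fin r) (Fin r) ℂ) : Prop :=
  ∀ z ∈ spectrum ℂ M, z.re < 0

/-- A matrix over `𝕜 = ℝ` or `𝕜 = ℂ`, regarded as a complex matrix. -/
def cplx {𝕜 : Type*} [RCLike 𝕜] {a b : ℕ} (M : Matrix (Fin a) (Fin b) 𝕜) :
    Matrix (Fin a) (Fin b) ℂ :=
  M.map fun z => (⟨RCLike.re z, RCLike.im z⟩ : ℂ)

/-- The transfer function `s ↦ C (sE - A)⁻¹ B`. -/
def transfer {𝕜 : Type*} [RCLike 𝕜] {n m p : ℕ} (E A : Matrix (Fin n) (Fin n) 𝕜)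
    (B : Matrix (Fin n) (Fin m) 𝕜) (C : Matrix (Fin p) (Fin n) 𝕜) (s : ℂ) :
    Matrix (Fin p) (Fin m) ℂ :=
  cplx C * (s • cplx E - cplx A)⁻¹ * cplx B

/-- The pencil `sE - A` is regular, i.e. `det (sE - A)` does not vanish identically. -/
def RegularPencil {𝕜 : Type*} [RCLike 𝕜] {n : ℕ} (E A : Matrix (Fin n) (Fin n) 𝕜) : Prop :=
  ∃ s : ℂ, (s • cplx E - cplx A).det ≠ 0

/-- `E` is invertible and `E⁻¹ A` is Hurwitz. -/
def StablePencil {𝕜 : Type*} [RCLike 𝕜] {n : ℕ} (E A : Matrix (Fin n) (Fin n) 𝕜) : Prop :=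
  IsUnit E ∧ Hurwitz (cplx (E⁻¹ * A))

/-- The element `G` of `H₂` is the function `s ↦ C (sE - A)⁻¹ B`. -/
def HasTransfer {𝕜 : Type*} [RCLike 𝕜] {n m p : ℕ} (G : HardySpace p m)
    (E A : Matrix (Fin n) (Fin n) 𝕜) (B : Matrix (Fin n) (Fin m) 𝕜)
    (C : Matrix (Fin p) (Fin n) 𝕜) : Prop :=
  IsHardyExtension (fun s => toVal (transfer E A B C s)) (G : Lp (Val p m) 2 axisMeasure)

/-- `(A, B, C)` is minimal: no realization over `𝕜` of the rational function `C (sI - A)⁻¹ B`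
has smaller order. Rational functions are compared off the poles of the two realizations. -/
def IsMinimal {𝕜 : Type*} [RCLike 𝕜] {r m p : ℕ} (A : Matrix (Fin r) (Fin r) 𝕜)
    (B : Matrix (Fin r) (Fin m) 𝕜) (C : Matrix (Fin p) (Fin r) 𝕜) : Prop :=
  ∀ (q : ℕ) (A' : Matrix (Fin q) (Fin q) 𝕜) (B' : Matrix (Fin q) (Fin m) 𝕜)
    (C' : Matrix (Fin p) (Fin q) 𝕜),
    (∀ s : ℂ, s ∉ spectrum ℂ (cplx A) → s ∉ spectrum ℂ (cplx A') →
      transfer 1 A B C s = transfer 1 A' B' C' s) → r ≤ q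

/-- The set `Σ⁻_{r,m,p}(𝕜)` of stable rational functions of McMillan degree `r`. -/
def stableManifold (𝕜 : Type*) [RCLike 𝕜] (r m p : ℕ) : Set (HardySpace p m) :=
  {G | ∃ (A : Matrix (Fin r) (Fin r) 𝕜) (B : Matrix (Fin r) (Fin m) 𝕜)
    (C : Matrix (Fin p) (Fin r) 𝕜),
    Hurwitz (cplx A) ∧ IsMinimal A B C ∧ HasTransfer G 1 A B C}

/-! ### Riemannian notions for a subset of a complex inner product space

The real part of the inner product is the real inner product. On a complex subspace, being
orthogonal for it is the same as being orthogonal for the complex inner product; on real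
transfer functions, the complex inner product is already real. -/

section Riemann

variable {X : Type*} [NormedAddCommGroup X] [InnerProductSpace ℂ X]

/-- The tangent space at `x`: velocities at `x` of the smooth curves in `M` through `x`. -/
def tangentSet (M : Set X) (x : X) : Set X :=
  {v | ∃ (c : ℝ → X) (ε : ℝ), 0 < ε ∧ ContDiffOn ℝ (⊤ : ℕ∞) c (Set.Ioo (-ε) ε) ∧
    (∀ t ∈ Set.Ioo (-ε) ε, c t ∈ M) ∧ c 0 = x ∧ HasDerivAt c v 0}

/-- The normal space at `x`: the orthogonal complement of the tangent space. -/
def normalSet (M : Set X) (x : X) : Set X :=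
  {w | ∀ v ∈ tangentSet M x, (inner ℂ v w).re = 0}

/-- `u` is the (Wirtinger) gradient at `x` of the real-valued function `f`, that is, half of the
gradient for the real inner product: `f (x + h) = f x + 2 Re ⟨u, h⟩ + o(h)`. -/
def IsWirtingerGradient (f : X → ℝ) (x u : X) : Prop :=
  ∃ L : X →L[ℝ] ℝ, HasFDerivAt f L x ∧ ∀ h : X, L h = 2 * (inner ℂ u h).re

/-- `g` is the Riemannian gradient at `x` of the restriction of `f` to `M`: the orthogonal
projection onto the tangent space at `x` of the ambient Wirtinger gradient of `f`. -/
def IsRiemannianGradient (M : Set X) (f : X → ℝ) (x g : X) : Prop :=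
  g ∈ tangentSet M x ∧ ∃ u : X, IsWirtingerGradient f x u ∧ u - g ∈ normalSet M x

/-- The orthographic retraction `R` of `M` is defined at the tangent vector `v` at `x`, and
`R_x(v) = y`: among the normal vectors `w` at `x` such that `x + v + w ∈ M`, there is one and
only one smallest, and `y = x + v + w` for this `w`. -/
def IsOrthographicRetraction (M : Set X) (x v y : X) : Prop :=
  y ∈ M ∧ y - (x + v) ∈ normalSet M x ∧
    ∀ z ∈ M, z - (x + v) ∈ normalSet M x → z ≠ y → ‖y - (x + v)‖ < ‖z - (x + v)‖

end Riemann

/-- The squared `H₂` error `f(G) = ‖H - G‖²`. -/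
def h2Error {p m : ℕ} (H G : HardySpace p m) : ℝ := ‖H - G‖ ^ 2

/-- The update `X - α (X - Y)`. -/
def relax {a b : ℕ} (α : ℝ) (X Y : Matrix (Fin a) (Fin b) ℝ) : Matrix (Fin a) (Fin b) ℝ :=
  X - α • (X - Y)

end H2Red

end

open H2Red

/-! Absorb the descriptor matrices, so that Hₖ = C R B with R = (sI - Aₖ)⁻¹. Moving the realization
along (Z, X, Y) shows that C R Z R B + Y R B + C R X is tangent at Hₖ (`exists_mem_tangentSet`); the
proof never needs that every tangent vector has this form. The pairing of such a vector with a
stable function C'(sI - A')⁻¹B' is tr(Z*SP) + tr(Y*C'P) + tr(X*SB'), where P and S solve the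
Sylvester equations that couple the two systems (`integral_trace_tangent`). Normality of a
combination of transfer functions therefore forces the same combination of their triples (SP, C'P,
SB') to vanish: take that combination itself as (Z, Y, X), and the pairing becomes a sum of squared
Frobenius norms (`interpolation_of_mem_normalSet`).

Since the ambient gradient is Hₖ - H, the point y returned by the retraction makes y - (1 - α)Hₖ -
αH normal (`normalSet_step`). So the triple of y is (1 - α) times that of Hₖ plus α times that of H.
The update is designed so that multiplying the new matrices by EₖᵀQ̂ and P̂ yields exactly these
combinations (`compress_relax`); the remaining product SA'P is read off from the Sylvester equation
for S. Hence EₖᵀQ̂(sE₊ - A₊)P̂ = S(sI - A')P. Regularity of the left pencil makes S and P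
invertible, and the new matrices are then equivalent to the realization of y
(`realization_of_factorization`).

Minimality of Hₖ makes the Gramians invertible (`IsMinimal.isUnit_gramian`). Regularity fails only
at roots of a nonzero polynomial in α of degree at most r (`encard_not_regularPencil_le`). -/

namespace H2Red

/-! ### Complexification of matrices -/

section Cplx

variable {𝕜 : Type*} [RCLike 𝕜] {a b c : ℕ}

/-- The embedding of `𝕜 = ℝ` or `𝕜 = ℂ` into `ℂ`. -/
def cplxHom (𝕜 : Type*) [RCLike 𝕜] : 𝕜 →+* ℂ where
  toFun z := ⟨RCLike.re z, RCLike.im z⟩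
  map_one' := by apply Complex.ext <;> simp
  map_mul' x y := by apply Complex.ext <;> simp [RCLike.mul_re, RCLike.mul_im]
  map_zero' := by apply Complex.ext <;> simp
  map_add' x y := by apply Complex.ext <;> simp

theorem cplx_eq_map (M : Matrix (Fin a) (Fin b) 𝕜) : cplx M = M.map (cplxHom 𝕜) := rfl

theorem cplxHom_ofReal (t : ℝ) : cplxHom 𝕜 (t : 𝕜) = (t : ℂ) := by
  apply Complex.ext <;> simp [cplxHom]

theorem cplxHom_star (z : 𝕜) : cplxHom 𝕜 (star z) = star (cplxHom 𝕜 z) := by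
  apply Complex.ext <;> simp [cplxHom]

theorem cplx_injective :
    Function.Injective (cplx : Matrix (Fin a) (Fin b) 𝕜 → Matrix (Fin a) (Fin b) ℂ) :=
  Matrix.map_injective (cplxHom 𝕜).injective

theorem cplx_mul (M : Matrix (Fin a) (Fin b) 𝕜) (N : Matrix (Fin b) (Fin c) 𝕜) :
    cplx (M * N) = cplx M * cplx N := by
  simp only [cplx_eq_map, Matrix.map_mul]

theorem cplx_add (M N : Matrix (Fin a) (Fin b) 𝕜) : cplx (M + N) = cplx M + cplx N :=
  Matrix.map_add _ (map_add (cplxHom 𝕜)) M N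

theorem cplx_sub (M N : Matrix (Fin a) (Fin b) 𝕜) : cplx (M - N) = cplx M - cplx N :=
  Matrix.map_sub _ (map_sub (cplxHom 𝕜)) M N

theorem cplx_zero : cplx (0 : Matrix (Fin a) (Fin b) 𝕜) = 0 :=
  Matrix.map_zero _ (map_zero (cplxHom 𝕜))

theorem cplx_one : cplx (1 : Matrix (Fin a) (Fin a) 𝕜) = 1 :=
  Matrix.map_one _ (map_zero (cplxHom 𝕜)) (map_one (cplxHom 𝕜))

theorem cplx_real_smul (t : ℝ) (M : Matrix (Fin a) (Fin b) 𝕜) :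
    cplx (t • M) = (t : ℂ) • cplx M := by
  ext i j
  simp only [cplx_eq_map, Matrix.map_apply, Matrix.smul_apply, RCLike.real_smul_eq_coe_mul,
    map_mul, cplxHom_ofReal, smul_eq_mul]

theorem cplx_conjTranspose (M : Matrix (Fin a) (Fin b) 𝕜) :
    cplx M.conjTranspose = (cplx M).conjTranspose := by
  ext i j
  simp [cplx_eq_map, ← cplxHom_star]

theorem cplx_transpose (M : Matrix (Fin a) (Fin b) 𝕜) :
    cplx M.transpose = (cplx M).transpose := rfl

theorem isUnit_cplx_iff {M : Matrix (Fin a) (Fin a) 𝕜} : IsUnit (cplx M) ↔ IsUnit M := by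
  rw [Matrix.isUnit_iff_isUnit_det, Matrix.isUnit_iff_isUnit_det, cplx_eq_map,
    show M.map (cplxHom 𝕜) = (cplxHom 𝕜).mapMatrix M from rfl, ← RingHom.map_det,
    isUnit_iff_ne_zero, isUnit_iff_ne_zero, Ne, map_eq_zero]

theorem cplx_inv (M : Matrix (Fin a) (Fin a) 𝕜) : cplx M⁻¹ = (cplx M)⁻¹ := by
  by_cases h : IsUnit M
  · symm
    apply Matrix.inv_eq_left_inv
    rw [← cplx_mul, Matrix.nonsing_inv_mul _ ((Matrix.isUnit_iff_isUnit_det _).1 h), cplx_one]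
  · have h' : ¬ IsUnit (cplx M) := fun h' => h (isUnit_cplx_iff.1 h')
    rw [Matrix.isUnit_iff_isUnit_det] at h h'
    rw [Matrix.nonsing_inv_apply_not_isUnit _ h, Matrix.nonsing_inv_apply_not_isUnit _ h',
      cplx_zero]

/-- A real matrix, regarded as a matrix over `𝕜`. -/
def ofRealMat (𝕜 : Type*) [RCLike 𝕜] {a b : ℕ} (M : Matrix (Fin a) (Fin b) ℝ) :
    Matrix (Fin a) (Fin b) 𝕜 :=
  M.map fun t => (t : 𝕜)

theorem cplx_ofRealMat (M : Matrix (Fin a) (Fin b) ℝ) : cplx (ofRealMat 𝕜 M) = cplx M := by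
  ext i j
  apply Complex.ext <;> simp [cplx, ofRealMat]

end Cplx

theorem cplx_conjTranspose_real {a b : ℕ} (M : Matrix (Fin a) (Fin b) ℝ) :
    (cplx M).conjTranspose = cplx M.transpose := by
  rw [← cplx_conjTranspose, Matrix.conjTranspose_eq_transpose_of_trivial]

/-! ### Resolvents of Hurwitz matrices -/

/-- The resolvent `(sI - A)⁻¹`. -/
noncomputable def res {n : ℕ} (A : Matrix (Fin n) (Fin n) ℂ) (s : ℂ) : Matrix (Fin n) (Fin n) ℂ :=
  (s • 1 - A)⁻¹

theorem transfer_one {𝕜 : Type*} [RCLike 𝕜] {n m p : ℕ} (A : Matrix (Fin n) (Fin n) 𝕜)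
    (B : Matrix (Fin n) (Fin m) 𝕜) (C : Matrix (Fin p) (Fin n) 𝕜) (s : ℂ) :
    transfer 1 A B C s = cplx C * res (cplx A) s * cplx B := by
  rw [transfer, cplx_one, res]

section Res

variable {n : ℕ} {A : Matrix (Fin n) (Fin n) ℂ} {s : ℂ}

theorem not_mem_spectrum_iff :
    s ∉ spectrum ℂ A ↔ IsUnit (s • (1 : Matrix (Fin n) (Fin n) ℂ) - A) := by
  rw [spectrum.notMem_iff, Algebra.algebraMap_eq_smul_one]

theorem Hurwitz.isUnit (hA : Hurwitz A) (hs : 0 ≤ s.re) :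
    IsUnit (s • (1 : Matrix (Fin n) (Fin n) ℂ) - A) :=
  not_mem_spectrum_iff.1 fun h => absurd (hA s h) (not_lt.2 hs)

theorem res_mul (h : IsUnit (s • (1 : Matrix (Fin n) (Fin n) ℂ) - A)) :
    res A s * (s • 1 - A) = 1 :=
  Matrix.nonsing_inv_mul _ ((Matrix.isUnit_iff_isUnit_det _).1 h)

theorem mul_res (h : IsUnit (s • (1 : Matrix (Fin n) (Fin n) ℂ) - A)) :
    (s • 1 - A) * res A s = 1 :=
  Matrix.mul_nonsing_inv _ ((Matrix.isUnit_iff_isUnit_det _).1 h)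

theorem res_eq_resolvent : res A s = resolvent A s := by
  rw [res, resolvent, Algebra.algebraMap_eq_smul_one, Matrix.nonsing_inv_eq_ringInverse]

theorem conjTranspose_res (A : Matrix (Fin n) (Fin n) ℂ) (s : ℂ) :
    (res A s).conjTranspose = res A.conjTranspose (star s) := by
  rw [res, res, Matrix.conjTranspose_nonsing_inv, Matrix.conjTranspose_sub,
    Matrix.conjTranspose_smul, Matrix.conjTranspose_one]

theorem Hurwitz.conjTranspose (hA : Hurwitz A) : Hurwitz A.conjTranspose := by
  intro z hz
  rw [← Matrix.star_eq_conjTranspose, spectrum.map_star] at hz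
  simpa using hA _ hz

open scoped Matrix.Norms.Operator

theorem Hurwitz.differentiableAt_res (hA : Hurwitz A) (hs : 0 ≤ s.re) :
    DifferentiableAt ℂ (res A) s := by
  have : res A = resolvent A := funext fun _ => res_eq_resolvent
  rw [this]
  exact (spectrum.hasDerivAt_resolvent_const_left
    (Set.notMem_compl_iff.1 (not_mem_spectrum_iff.2 (hA.isUnit hs)))).differentiableAt

theorem tendsto_res_cobounded (A : Matrix (Fin n) (Fin n) ℂ) :
    Tendsto (res A) (Bornology.cobounded ℂ) (𝓝 0) := by
  have : res A = resolvent A := funext fun _ => res_eq_resolvent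
  rw [this]
  exact spectrum.resolvent_tendsto_cobounded A

/-- Near infinity the resolvent is O(1/|s|); on the compact rest of the closed right half-plane it
is continuous, hence bounded. -/
theorem Hurwitz.exists_norm_res_le (hA : Hurwitz A) :
    ∃ K : ℝ, 0 ≤ K ∧ ∀ s : ℂ, 0 ≤ s.re → ‖res A s‖ ≤ K / (1 + ‖s‖) := by
  have hfun : res A = resolvent A := funext fun _ => res_eq_resolvent
  obtain ⟨c, hc0, hc⟩ := (spectrum.resolvent_isBigO_inv (𝕜 := ℂ) A).exists_pos
  rw [Asymptotics.isBigOWith_iff, ← hfun, (hasBasis_cobounded_norm).eventually_iff] at hc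
  obtain ⟨r, -, hr⟩ := hc
  set ρ := max r 1 with hρ
  have hcomp : IsCompact ({s : ℂ | 0 ≤ s.re} ∩ Metric.closedBall 0 ρ) :=
    (isCompact_closedBall 0 ρ).inter_left (isClosed_le continuous_const Complex.continuous_re)
  obtain ⟨M, hM⟩ := hcomp.exists_bound_of_continuousOn (f := res A)
    fun s hs => (hA.differentiableAt_res hs.1).continuousAt.continuousWithinAt
  refine ⟨max (2 * c) (M * (1 + ρ)), le_max_of_le_left (by positivity), fun s hs => ?_⟩
  rw [le_div_iff₀ (by positivity)]
  rcases le_total ‖s‖ ρ with h | h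
  · have h1 := hM s ⟨hs, by simpa using h⟩
    have h2 : 0 ≤ M := (norm_nonneg _).trans h1
    exact (mul_le_mul h1 (by linarith) (by positivity) h2).trans (le_max_right _ _)
  · have h1 : ‖res A s‖ ≤ c * ‖s⁻¹‖ := hr ((le_max_left r 1).trans h)
    have h2 : 1 ≤ ‖s‖ := (le_max_right r 1).trans h
    refine le_trans ?_ (le_max_left _ _)
    rw [norm_inv] at h1
    calc ‖res A s‖ * (1 + ‖s‖) ≤ (c * ‖s‖⁻¹) * (‖s‖ + ‖s‖) := by gcongr
      _ = 2 * c := by field_simp; ring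

end Res

/-! ### Sylvester equations -/

section Sylvester

/-- From AX = X(-D) follows q(A)X = Xq(-D) for every polynomial q. For q the characteristic
polynomial of A the left side vanishes by Cayley-Hamilton, while q(-D) is invertible because A and
-D have no common eigenvalue. -/
theorem sylvester_eq_zero {n r : ℕ} {A : Matrix (Fin n) (Fin n) ℂ} {D : Matrix (Fin r) (Fin r) ℂ}
    (hA : Hurwitz A) (hD : Hurwitz D) {X : Matrix (Fin n) (Fin r) ℂ}
    (h : A * X + X * D = 0) : X = 0 := by
  -- The spectral mapping theorem used below asks for a polynomial of positive degree.
  rcases Nat.eq_zero_or_pos n with rfl | hn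
  · exact Subsingleton.elim _ _
  have h1 : ∀ q : Polynomial ℂ, Polynomial.aeval A q * X = X * Polynomial.aeval (-D) q := by
    intro q
    induction q using Polynomial.induction_on' with
    | add p q hp hq => simp [Matrix.add_mul, Matrix.mul_add, hp, hq]
    | monomial k c =>
      have hk : ∀ k : ℕ, A ^ k * X = X * (-D) ^ k := by
        intro k
        induction k with
        | zero => simp
        | succ k ih =>
          have : A * X = X * (-D) := by
            rw [Matrix.mul_neg]; exact eq_neg_of_add_eq_zero_left h
          rw [pow_succ, Matrix.mul_assoc, this, ← Matrix.mul_assoc, ih, Matrix.mul_assoc, pow_succ]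
      simp only [Polynomial.aeval_monomial, Algebra.algebraMap_eq_smul_one, Matrix.smul_mul,
        Matrix.mul_smul, Matrix.one_mul, hk]
  have h2 := h1 A.charpoly
  rw [Matrix.aeval_self_charpoly, Matrix.zero_mul] at h2
  have h3 : IsUnit (Polynomial.aeval (-D) A.charpoly) := by
    rw [← spectrum.zero_notMem_iff ℂ, spectrum.map_polynomial_aeval_of_degree_pos]
    · rintro ⟨z, hz, hz0⟩
      have hz' : -z ∈ spectrum ℂ D := by
        rw [← spectrum.neg_eq] at hz
        simpa using hz
      have h4 := hD _ hz'
      have h5 := hA z (Matrix.mem_spectrum_iff_isRoot_charpoly.2 hz0)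
      simp at h4
      linarith
    · have : Nonempty (Fin n) := ⟨⟨0, hn⟩⟩
      rw [Matrix.charpoly_degree_eq_dim]
      simpa using hn
  obtain ⟨U, hU⟩ := h3
  have : X = X * (U : Matrix (Fin r) (Fin r) ℂ) * (↑U⁻¹ : Matrix (Fin r) (Fin r) ℂ) := by
    rw [Matrix.mul_assoc, Units.mul_inv, Matrix.mul_one]
  rw [this, hU, ← h2, Matrix.zero_mul]

/-- An injective endomorphism of a finite-dimensional space is bijective; injectivity can be checked
after complexification. -/
theorem existsUnique_sylvester {𝕜 : Type*} [RCLike 𝕜] {n r : ℕ} {A : Matrix (Fin n) (Fin n) 𝕜}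
    {D : Matrix (Fin r) (Fin r) 𝕜} (hA : Hurwitz (cplx A)) (hD : Hurwitz (cplx D))
    (M : Matrix (Fin n) (Fin r) 𝕜) :
    ∃! X : Matrix (Fin n) (Fin r) 𝕜, A * X + X * D + M = 0 := by
  let L : Matrix (Fin n) (Fin r) 𝕜 →ₗ[𝕜] Matrix (Fin n) (Fin r) 𝕜 :=
    { toFun := fun X => A * X + X * D
      map_add' := fun X Y => by rw [Matrix.mul_add, Matrix.add_mul]; abel
      map_smul' := fun c X => by simp }
  have hinj : Function.Injective L := by
    rw [injective_iff_map_eq_zero]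
    intro X hX
    apply cplx_injective
    rw [cplx_zero]
    apply sylvester_eq_zero hA hD
    rw [← cplx_mul, ← cplx_mul, ← cplx_add, ← cplx_zero (𝕜 := 𝕜)]
    exact congrArg cplx hX
  obtain ⟨X, hX⟩ := (LinearMap.injective_iff_surjective.1 hinj) (-M)
  refine ⟨X, ?_, fun Y hY => hinj ?_⟩
  · change L X + M = 0
    rw [hX, neg_add_cancel]
  · rw [hX]
    exact eq_neg_of_add_eq_zero_left hY

end Sylvester

/-! ### Markov parameters -/

section Markov

open scoped Matrix.Norms.Operator

variable {n q m p : ℕ}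

theorem eventually_isUnit_smul_one_sub (A : Matrix (Fin n) (Fin n) ℂ) :
    ∀ᶠ s in Bornology.cobounded ℂ, IsUnit (s • (1 : Matrix (Fin n) (Fin n) ℂ) - A) := by
  filter_upwards [spectrum.eventually_isUnit_resolvent (𝕜 := ℂ) A] with s hs
  have := spectrum.isUnit_resolvent.2 hs
  rwa [spectrum.mem_resolventSet_iff, Algebra.algebraMap_eq_smul_one] at this

theorem mul_res_eq {A : Matrix (Fin n) (Fin n) ℂ} {s : ℂ}
    (h : IsUnit (s • (1 : Matrix (Fin n) (Fin n) ℂ) - A)) :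
    A * res A s = s • res A s - 1 := by
  have := mul_res h
  rw [Matrix.sub_mul, Matrix.smul_mul, Matrix.one_mul] at this
  rw [← this, sub_sub_cancel]

theorem tendsto_smul_res (A : Matrix (Fin n) (Fin n) ℂ) :
    Tendsto (fun s => s • res A s) (Bornology.cobounded ℂ) (𝓝 1) := by
  have h1 : Tendsto (fun s => 1 + A * res A s) (Bornology.cobounded ℂ) (𝓝 (1 + A * 0)) :=
    ((tendsto_res_cobounded A).const_mul A).const_add 1
  rw [mul_zero, add_zero] at h1
  refine h1.congr' ?_
  filter_upwards [eventually_isUnit_smul_one_sub A] with s hs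
  rw [mul_res_eq hs]
  abel

theorem tendsto_smul_mul_res_mul (A : Matrix (Fin n) (Fin n) ℂ) (L : Matrix (Fin p) (Fin n) ℂ)
    (N : Matrix (Fin n) (Fin m) ℂ) :
    Tendsto (fun s => s • (L * res A s * N)) (Bornology.cobounded ℂ) (𝓝 (L * N)) := by
  have hc : Continuous fun X : Matrix (Fin n) (Fin n) ℂ => L * X * N := by fun_prop
  have := (hc.tendsto 1).comp (tendsto_smul_res A)
  simpa [Function.comp_def] using this

/-- Transfer functions that agree near infinity along some filter have the same Markov
parameters. -/
theorem markov_eq {l : Filter ℂ} [l.NeBot] (hl : l ≤ Bornology.cobounded ℂ)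
    {A : Matrix (Fin n) (Fin n) ℂ} {B : Matrix (Fin n) (Fin m) ℂ} {C : Matrix (Fin p) (Fin n) ℂ}
    {A' : Matrix (Fin q) (Fin q) ℂ} {B' : Matrix (Fin q) (Fin m) ℂ} {C' : Matrix (Fin p) (Fin q) ℂ}
    (h : ∀ᶠ s in l, C * res A s * B = C' * res A' s * B') (k : ℕ) :
    C * A ^ k * B = C' * A' ^ k * B' := by
  -- C Aᵏ B is the limit of s · C Aᵏ (sI - A)⁻¹ B at infinity. The identity A(sI - A)⁻¹ = s(sI -
  -- A)⁻¹ - I then carries the agreement of the functions from k to k + 1.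
  have key : ∀ k : ℕ, (∀ᶠ s in l, C * A ^ k * res A s * B = C' * A' ^ k * res A' s * B') →
      C * A ^ k * B = C' * A' ^ k * B' := by
    intro k hk
    refine tendsto_nhds_unique_of_eventuallyEq
      ((tendsto_smul_mul_res_mul A (C * A ^ k) B).mono_left hl)
      ((tendsto_smul_mul_res_mul A' (C' * A' ^ k) B').mono_left hl) ?_
    filter_upwards [hk] with s hs
    rw [hs]
  refine key k ?_
  induction k with
  | zero => simpa using h
  | succ k ih =>
    filter_upwards [ih, hl (eventually_isUnit_smul_one_sub A),
      hl (eventually_isUnit_smul_one_sub A')] with s hs h1 h2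
    have e1 : C * A ^ (k + 1) * res A s * B = s • (C * A ^ k * res A s * B) - C * A ^ k * B := by
      rw [pow_succ, ← Matrix.mul_assoc, Matrix.mul_assoc (C * A ^ k), mul_res_eq h1]
      simp [Matrix.mul_sub, Matrix.sub_mul]
    have e2 : C' * A' ^ (k + 1) * res A' s * B'
        = s • (C' * A' ^ k * res A' s * B') - C' * A' ^ k * B' := by
      rw [pow_succ, ← Matrix.mul_assoc, Matrix.mul_assoc (C' * A' ^ k), mul_res_eq h2]
      simp [Matrix.mul_sub, Matrix.sub_mul]
    rw [e1, e2, hs, key k ih]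

end Markov

/-! ### Minimal realizations -/

section Minimal

variable {𝕜 : Type*} [RCLike 𝕜] {r m p : ℕ}

theorem cplx_pow {a : ℕ} (M : Matrix (Fin a) (Fin a) 𝕜) (k : ℕ) : cplx (M ^ k) = cplx M ^ k := by
  induction k with
  | zero => simp [cplx_one]
  | succ k ih => rw [pow_succ, pow_succ, cplx_mul, ih]

theorem markov_eq_of_transfer {q : ℕ} {l : Filter ℂ} [l.NeBot] (hl : l ≤ Bornology.cobounded ℂ)
    {A : Matrix (Fin r) (Fin r) 𝕜} {B : Matrix (Fin r) (Fin m) 𝕜} {C : Matrix (Fin p) (Fin r) 𝕜}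
    {A' : Matrix (Fin q) (Fin q) 𝕜} {B' : Matrix (Fin q) (Fin m) 𝕜} {C' : Matrix (Fin p) (Fin q) 𝕜}
    (h : ∀ᶠ s in l, transfer 1 A B C s = transfer 1 A' B' C' s) (k : ℕ) :
    C * A ^ k * B = C' * A' ^ k * B' := by
  simp only [transfer_one] at h
  apply cplx_injective
  simpa only [cplx_mul, cplx_pow] using markov_eq hl h k

/-- A realization with a nonsingular compressed Hankel matrix is minimal. -/
theorem isMinimal_of_hankel {A : Matrix (Fin r) (Fin r) 𝕜} {B : Matrix (Fin r) (Fin m) 𝕜}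
    {C : Matrix (Fin p) (Fin r) 𝕜} (N M : ℕ) (L : ℕ → Matrix (Fin r) (Fin p) 𝕜)
    (K : ℕ → Matrix (Fin m) (Fin r) 𝕜)
    (h : (∑ i ∈ Finset.range N, ∑ j ∈ Finset.range M, L i * (C * A ^ (i + j) * B) * K j).det ≠ 0) :
    IsMinimal A B C := by
  intro q A' B' C' hT
  have hmk : ∀ k : ℕ, C * A ^ k * B = C' * A' ^ k * B' := by
    refine markov_eq_of_transfer (l := Bornology.cobounded ℂ) le_rfl ?_
    filter_upwards [eventually_isUnit_smul_one_sub (cplx A),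
      eventually_isUnit_smul_one_sub (cplx A')] with s h1 h2
    exact hT s (not_mem_spectrum_iff.2 h1) (not_mem_spectrum_iff.2 h2)
  -- The competing realization has the same Markov parameters, so the compressed Hankel matrix
  -- factors through its q-dimensional state space.
  have hfac : (∑ i ∈ Finset.range N, ∑ j ∈ Finset.range M, L i * (C * A ^ (i + j) * B) * K j)
      = (∑ i ∈ Finset.range N, L i * C' * A' ^ i) * (∑ j ∈ Finset.range M, A' ^ j * B' * K j) := by
    rw [Matrix.sum_mul]
    refine Finset.sum_congr rfl fun i _ => ?_
    rw [Matrix.mul_sum]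
    refine Finset.sum_congr rfl fun j _ => ?_
    rw [hmk, pow_add]
    simp only [Matrix.mul_assoc]
  rw [hfac] at h
  have h1 := Matrix.rank_of_isUnit _ ((Matrix.isUnit_iff_isUnit_det _).2 (isUnit_iff_ne_zero.2 h))
  rw [Fintype.card_fin] at h1
  calc r ≤ _ := h1.ge
    _ ≤ _ := Matrix.rank_mul_le_left _ _
    _ ≤ q := by simpa using Matrix.rank_le_card_width (∑ i ∈ Finset.range N, L i * C' * A' ^ i)

/-- Duality: it turns statements on controllability into statements on observability. -/
theorem IsMinimal.transpose {A : Matrix (Fin r) (Fin r) 𝕜} {B : Matrix (Fin r) (Fin m) 𝕜}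
    {C : Matrix (Fin p) (Fin r) 𝕜} (h : IsMinimal A B C) :
    IsMinimal A.transpose C.transpose B.transpose := by
  have hT : ∀ {q m p : ℕ} (A : Matrix (Fin q) (Fin q) 𝕜) (B : Matrix (Fin q) (Fin m) 𝕜)
      (C : Matrix (Fin p) (Fin q) 𝕜) (s : ℂ),
      transfer 1 A.transpose C.transpose B.transpose s = (transfer 1 A B C s).transpose := by
    intro q m p A B C s
    simp only [transfer_one, res, cplx_transpose, Matrix.transpose_mul,
      Matrix.transpose_nonsing_inv, Matrix.transpose_sub, Matrix.transpose_smul,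
      Matrix.transpose_one, Matrix.mul_assoc]
  have hS : ∀ {q : ℕ} (A : Matrix (Fin q) (Fin q) 𝕜) (s : ℂ),
      s ∉ spectrum ℂ (cplx A) → s ∉ spectrum ℂ (cplx A.transpose) := by
    intro q A s hs
    rw [not_mem_spectrum_iff, Matrix.isUnit_iff_isUnit_det] at hs ⊢
    rw [cplx_transpose, ← Matrix.det_transpose]
    simpa using hs
  intro q A' B' C' heq
  refine h q A'.transpose C'.transpose B'.transpose fun s h1 h2 => ?_
  have h3 := heq s (hS _ _ h1) (by simpa using hS _ _ h2)
  rw [hT] at h3 ⊢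
  rw [← h3, Matrix.transpose_transpose]

/-- For a minimal realization, an `A`-invariant subspace that contains the range of `B` is the
whole space. -/
theorem IsMinimal.eq_top {A : Matrix (Fin r) (Fin r) 𝕜} {B : Matrix (Fin r) (Fin m) 𝕜}
    {C : Matrix (Fin p) (Fin r) 𝕜} (h : IsMinimal A B C) (W : Submodule 𝕜 (Fin r → 𝕜))
    (hA : ∀ w ∈ W, A.mulVec w ∈ W) (hB : ∀ k, B.mulVec k ∈ W) : W = ⊤ := by
  -- In a basis U of W, invariance reads AU = UA' and B = UB', so (A', B', CU) realizes the same
  -- function with order dim W; minimality gives r ≤ dim W.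
  set q := Module.finrank 𝕜 W with hq
  let b := Module.finBasis 𝕜 W
  let U : Matrix (Fin r) (Fin q) 𝕜 := Matrix.of fun i j => (b j : Fin r → 𝕜) i
  let A' : Matrix (Fin q) (Fin q) 𝕜 :=
    Matrix.of fun i j => b.repr ⟨A.mulVec (b j), hA _ (b j).2⟩ i
  let B' : Matrix (Fin q) (Fin m) 𝕜 :=
    Matrix.of fun i j => b.repr ⟨B.mulVec (Pi.single j 1), hB _⟩ i
  have hU : ∀ w : W, ∀ i, ∑ j, U i j * b.repr w j = (w : Fin r → 𝕜) i := by
    intro w i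
    have := congrFun (congrArg Subtype.val (b.sum_repr w)) i
    rw [← this, Submodule.coe_sum, Finset.sum_apply]
    exact Finset.sum_congr rfl fun j _ => by simp [U, mul_comm]
  have hAU : A * U = U * A' := by
    ext i j
    rw [Matrix.mul_apply, Matrix.mul_apply]
    simp only [A', Matrix.of_apply]
    rw [hU]
    simp [Matrix.mulVec, dotProduct, U]
  have hBU : B = U * B' := by
    ext i j
    rw [Matrix.mul_apply]
    simp only [B', Matrix.of_apply]
    rw [hU]
    simp
  have hle := h q A' B' (C * U) fun s h1 h2 => by
    rw [not_mem_spectrum_iff] at h1 h2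
    have e1 : cplx A * cplx U = cplx U * cplx A' := by rw [← cplx_mul, hAU, cplx_mul]
    have e2 : (s • 1 - cplx A) * cplx U = cplx U * (s • 1 - cplx A') := by
      simp [Matrix.sub_mul, Matrix.mul_sub, e1]
    have e3 : res (cplx A) s * cplx U = cplx U * res (cplx A') s := by
      calc res (cplx A) s * cplx U
          = res (cplx A) s * (cplx U * (s • 1 - cplx A')) * res (cplx A') s := by
            rw [Matrix.mul_assoc, Matrix.mul_assoc (cplx U), mul_res h2, Matrix.mul_one]
        _ = cplx U * res (cplx A') s := by
            rw [← e2, ← Matrix.mul_assoc, res_mul h1, Matrix.one_mul]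
    rw [transfer_one, transfer_one, hBU, cplx_mul, cplx_mul, Matrix.mul_assoc,
      ← Matrix.mul_assoc (res _ _), e3]
    simp only [Matrix.mul_assoc]
  apply Submodule.eq_top_of_finrank_eq
  rw [Module.finrank_fin_fun]
  refine le_antisymm ?_ hle
  simpa using Submodule.finrank_le W

/-- The reachable space, spanned by the ranges of all AʲB, is invariant and contains the range of B,
so it is everything. The columns of the `K j` collect preimages of the standard basis vectors. -/
theorem IsMinimal.exists_controllability {A : Matrix (Fin r) (Fin r) 𝕜}
    {B : Matrix (Fin r) (Fin m) 𝕜} {C : Matrix (Fin p) (Fin r) 𝕜} (h : IsMinimal A B C) :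
    ∃ (N : ℕ) (K : ℕ → Matrix (Fin m) (Fin r) 𝕜),
      ∑ j ∈ Finset.range N, A ^ j * B * K j = 1 := by
  let Φ : (ℕ →₀ (Fin m → 𝕜)) →ₗ[𝕜] (Fin r → 𝕜) :=
    Finsupp.lsum ℕ fun j => (A ^ j * B).mulVecLin
  have hsingle : ∀ j k, Φ (Finsupp.single j k) = (A ^ j * B).mulVec k := by
    intro j k; simp [Φ]
  have htop : LinearMap.range Φ = ⊤ := by
    refine h.eq_top _ ?_ fun k => ⟨Finsupp.single 0 k, by simp [hsingle]⟩
    rintro _ ⟨f, rfl⟩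
    induction f using Finsupp.induction_linear with
    | zero => simp
    | add f g hf hg => rw [map_add, Matrix.mulVec_add]; exact add_mem hf hg
    | single j k =>
      refine ⟨Finsupp.single (j + 1) k, ?_⟩
      rw [hsingle, hsingle, Matrix.mulVec_mulVec, ← Matrix.mul_assoc, pow_succ']
  have hsurj : ∀ w, ∃ f, Φ f = w := LinearMap.range_eq_top.1 htop
  choose f hf using fun i : Fin r => hsurj (Pi.single i 1)
  let S := Finset.univ.biUnion fun i => (f i).support
  obtain ⟨N, hN⟩ : ∃ N, S ⊆ Finset.range N := S.exists_nat_subset_range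
  refine ⟨N, fun j => Matrix.of fun a i => f i j a, ?_⟩
  ext a i
  have h1 : Φ (f i) = ∑ j ∈ Finset.range N, (A ^ j * B).mulVec (f i j) := by
    change (f i).sum _ = _
    refine Finsupp.sum_of_support_subset _ ?_ _ (by simp)
    exact (Finset.subset_biUnion_of_mem (fun i => (f i).support) (Finset.mem_univ i)).trans hN
  have h2 := congrFun (h1.symm.trans (hf i)) a
  rw [Finset.sum_apply] at h2
  rw [Matrix.sum_apply, Matrix.one_apply]
  rw [Pi.single_apply] at h2
  rw [← h2]
  rfl

theorem IsMinimal.exists_observability {A : Matrix (Fin r) (Fin r) 𝕜}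
    {B : Matrix (Fin r) (Fin m) 𝕜} {C : Matrix (Fin p) (Fin r) 𝕜} (h : IsMinimal A B C) :
    ∃ (N : ℕ) (L : ℕ → Matrix (Fin r) (Fin p) 𝕜),
      ∑ i ∈ Finset.range N, L i * C * A ^ i = 1 := by
  obtain ⟨N, K, hK⟩ := h.transpose.exists_controllability
  refine ⟨N, fun i => (K i).transpose, ?_⟩
  have := congrArg Matrix.transpose hK
  rw [Matrix.transpose_sum, Matrix.transpose_one] at this
  rw [← this]
  refine Finset.sum_congr rfl fun i _ => ?_
  simp [Matrix.transpose_mul, Matrix.transpose_pow, Matrix.mul_assoc]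

/-- Multiply a left inverse of the observability matrix and a right inverse of the controllability
matrix into their product. This certificate of minimality involves only Markov parameters, hence is
stable under perturbation and change of realization. -/
theorem IsMinimal.exists_hankel {A : Matrix (Fin r) (Fin r) 𝕜}
    {B : Matrix (Fin r) (Fin m) 𝕜} {C : Matrix (Fin p) (Fin r) 𝕜} (h : IsMinimal A B C) :
    ∃ (N M : ℕ) (L : ℕ → Matrix (Fin r) (Fin p) 𝕜) (K : ℕ → Matrix (Fin m) (Fin r) 𝕜),
      ∑ i ∈ Finset.range N, ∑ j ∈ Finset.range M, L i * (C * A ^ (i + j) * B) * K j = 1 := by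
  obtain ⟨N, L, hL⟩ := h.exists_observability
  obtain ⟨M, K, hK⟩ := h.exists_controllability
  refine ⟨N, M, L, K, ?_⟩
  calc _ = (∑ i ∈ Finset.range N, L i * C * A ^ i) * (∑ j ∈ Finset.range M, A ^ j * B * K j) := by
        rw [Matrix.sum_mul]
        refine Finset.sum_congr rfl fun i _ => ?_
        rw [Matrix.mul_sum]
        refine Finset.sum_congr rfl fun j _ => ?_
        rw [pow_add]
        simp only [Matrix.mul_assoc]
    _ = 1 := by rw [hL, hK, Matrix.one_mul]

theorem IsMinimal.of_markov {A A' : Matrix (Fin r) (Fin r) 𝕜}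
    {B B' : Matrix (Fin r) (Fin m) 𝕜} {C C' : Matrix (Fin p) (Fin r) 𝕜} (h : IsMinimal A B C)
    (hmk : ∀ k : ℕ, C * A ^ k * B = C' * A' ^ k * B') : IsMinimal A' B' C' := by
  obtain ⟨N, M, L, K, hLK⟩ := h.exists_hankel
  apply isMinimal_of_hankel N M L K
  simp only [← hmk, hLK, Matrix.det_one]
  exact one_ne_zero

/-- Minimality persists under small perturbations. -/
theorem IsMinimal.eventually {A : Matrix (Fin r) (Fin r) 𝕜}
    {B : Matrix (Fin r) (Fin m) 𝕜} {C : Matrix (Fin p) (Fin r) 𝕜} (h : IsMinimal A B C)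
    (Z : Matrix (Fin r) (Fin r) 𝕜) (X : Matrix (Fin r) (Fin m) 𝕜) (Y : Matrix (Fin p) (Fin r) 𝕜) :
    ∀ᶠ t : ℝ in 𝓝 0, IsMinimal (A + t • Z) (B + t • X) (C + t • Y) := by
  obtain ⟨N, M, L, K, hLK⟩ := h.exists_hankel
  let d : ℝ → 𝕜 := fun t => (∑ i ∈ Finset.range N, ∑ j ∈ Finset.range M,
    L i * ((C + t • Y) * (A + t • Z) ^ (i + j) * (B + t • X)) * K j).det
  have hd : Continuous d := by
    apply Continuous.matrix_det
    fun_prop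
  have h0 : d 0 ≠ 0 := by
    simp only [d, zero_smul, add_zero, hLK, Matrix.det_one]
    exact one_ne_zero
  filter_upwards [hd.continuousAt.eventually_ne h0] with t ht
  exact isMinimal_of_hankel N M L K ht

/-- The controllability Gramian of a minimal realization is invertible. -/
theorem IsMinimal.isUnit_gramian {A P : Matrix (Fin r) (Fin r) ℝ}
    {B : Matrix (Fin r) (Fin m) ℝ} {C : Matrix (Fin p) (Fin r) 𝕜}
    (h : IsMinimal (ofRealMat 𝕜 A) (ofRealMat 𝕜 B) C) (hA : Hurwitz (cplx A))
    (hP : A * P + P * A.transpose + B * B.transpose = 0) : IsUnit P := by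
  have hA' : Hurwitz (cplx A.transpose) := by
    rw [← cplx_conjTranspose_real]
    exact hA.conjTranspose
  have hsymm : P.transpose = P := by
    refine (existsUnique_sylvester hA hA' (B * B.transpose)).unique ?_ hP
    have := congrArg Matrix.transpose hP
    simp only [Matrix.transpose_add, Matrix.transpose_mul, Matrix.transpose_transpose,
      Matrix.transpose_zero] at this
    rw [← this]
    abel
  -- Evaluating the Lyapunov equation as a quadratic form at v in ker P leaves |Bᵀv|² = 0. Applying
  -- the equation to v then shows that ker P is Aᵀ-invariant.
  have hBv : ∀ v, P.mulVec v = 0 → B.transpose.mulVec v = 0 := by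
    intro v hv
    have h1 := congrArg (fun M => v ⬝ᵥ M.mulVec v) hP
    have hv' : Matrix.vecMul v P = 0 := by rw [← hsymm, Matrix.vecMul_transpose, hv]
    simp only [Matrix.add_mulVec, dotProduct_add, Matrix.zero_mulVec, dotProduct_zero] at h1
    rw [← Matrix.mulVec_mulVec, hv, Matrix.mulVec_zero, dotProduct_zero, zero_add,
      ← Matrix.mulVec_mulVec, Matrix.dotProduct_mulVec, hv', zero_dotProduct, zero_add,
      ← Matrix.mulVec_mulVec, Matrix.dotProduct_mulVec, ← Matrix.mulVec_transpose] at h1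
    exact dotProduct_self_eq_zero.1 h1
  have hAv : ∀ v, P.mulVec v = 0 → P.mulVec (A.transpose.mulVec v) = 0 := by
    intro v hv
    have h1 := congrArg (fun M => M.mulVec v) hP
    simp only [Matrix.add_mulVec, Matrix.zero_mulVec] at h1
    rw [← Matrix.mulVec_mulVec, hv, Matrix.mulVec_zero, zero_add,
      ← Matrix.mulVec_mulVec (M := B), hBv v hv, Matrix.mulVec_zero, add_zero,
      ← Matrix.mulVec_mulVec] at h1
    exact h1
  have hcast : ∀ {a b : ℕ} (M : Matrix (Fin a) (Fin b) ℝ) (v : Fin a → ℝ) (w : Fin b → 𝕜),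
      (fun i => (v i : 𝕜)) ⬝ᵥ (ofRealMat 𝕜 M).mulVec w
        = (fun i => ((M.transpose.mulVec v) i : 𝕜)) ⬝ᵥ w := by
    intro a b M v w
    rw [Matrix.dotProduct_mulVec]
    congr 1
    ext i
    simp [Matrix.vecMul, Matrix.mulVec, dotProduct, ofRealMat, mul_comm]
  -- The annihilator of ker P, taken over 𝕜 because minimality is known over 𝕜 while P is real. It
  -- is A-invariant and contains the range of B, so it is the whole space and ker P = 0.
  let W : Submodule 𝕜 (Fin r → 𝕜) :=
    { carrier := {w | ∀ v : Fin r → ℝ, P.mulVec v = 0 → (fun i => (v i : 𝕜)) ⬝ᵥ w = 0}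
      add_mem' := fun {a b} ha hb v hv => by rw [dotProduct_add, ha v hv, hb v hv, add_zero]
      zero_mem' := fun v _ => dotProduct_zero _
      smul_mem' := fun c w hw v hv => by rw [dotProduct_smul, hw v hv, smul_zero] }
  have hW : W = ⊤ := by
    refine h.eq_top W ?_ ?_
    · intro w hw v hv
      rw [hcast]
      exact hw _ (hAv v hv)
    · intro k v hv
      rw [hcast, hBv v hv]
      simp
  rw [← Matrix.mulVec_injective_iff_isUnit]
  refine (injective_iff_map_eq_zero (Matrix.mulVecLin P)).2 fun v hv => ?_
  ext i
  have hi : (Pi.single i 1 : Fin r → 𝕜) ∈ W := hW ▸ Submodule.mem_top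
  simpa using hi v hv

end Minimal

/-! ### Integrals along the imaginary axis -/

section Axis

theorem integrable_axis_of_bound {f : ℂ → ℂ} {K : ℝ}
    (hf : ∀ s : ℂ, 0 ≤ s.re → DifferentiableAt ℂ f s)
    (hK : ∀ s : ℂ, 0 ≤ s.re → ‖f s‖ ≤ K / (1 + ‖s‖) ^ 2) :
    Integrable fun ω : ℝ => f (ω * Complex.I) := by
  have hc : Continuous fun ω : ℝ => f (ω * Complex.I) := by
    rw [continuous_iff_continuousAt]
    intro ω
    exact ContinuousAt.comp (f := fun ω : ℝ => (ω * Complex.I : ℂ))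
      (hf _ (by simp)).continuousAt (by fun_prop)
  have hK0 : 0 ≤ K := by simpa using (norm_nonneg _).trans (hK 0 (by simp))
  refine (integrable_inv_one_add_sq.const_mul K).mono' hc.aestronglyMeasurable
    (Eventually.of_forall fun ω => ?_)
  refine (hK _ (by simp)).trans ?_
  rw [div_eq_mul_inv]
  gcongr
  simp only [norm_mul, Complex.norm_real, Complex.norm_I, mul_one, Real.norm_eq_abs]
  nlinarith [sq_abs ω, abs_nonneg ω]

/-- Cauchy's theorem for the right half-plane. -/
theorem integral_axis_eq_zero {f : ℂ → ℂ} {K : ℝ}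
    (hf : ∀ s : ℂ, 0 ≤ s.re → DifferentiableAt ℂ f s)
    (hK : ∀ s : ℂ, 0 ≤ s.re → ‖f s‖ ≤ K / (1 + ‖s‖) ^ 2) :
    ∫ ω : ℝ, f (ω * Complex.I) = 0 := by
  have hK0 : 0 ≤ K := by simpa using (norm_nonneg _).trans (hK 0 (by simp))
  have hlim := intervalIntegral_tendsto_integral (integrable_axis_of_bound hf hK)
    tendsto_neg_atTop_atBot tendsto_id
  refine tendsto_nhds_unique hlim ?_
  -- The contour is the boundary of [0, T] × [-T, T]. Its three sides off the axis have total length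
  -- 4T, and the integrand there is at most K/T².
  have hz : Tendsto (fun T : ℝ => 4 * K * T⁻¹) atTop (𝓝 0) := by
    simpa using tendsto_inv_atTop_zero.const_mul (4 * K)
  refine squeeze_zero_norm' ?_ hz
  filter_upwards [eventually_gt_atTop 0] with T hT
  have hb : ∀ s : ℂ, 0 ≤ s.re → T ≤ ‖s‖ → ‖f s‖ ≤ K / T ^ 2 := by
    intro s hs hTs
    refine (hK s hs).trans ?_
    gcongr
    linarith
  have hrect := Complex.integral_boundary_rect_eq_zero_of_differentiableOn f
    (⟨0, -T⟩ : ℂ) (⟨T, T⟩ : ℂ) (by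
      intro s hs
      refine (hf s ?_).differentiableWithinAt
      have := hs.1
      simp only [Set.mem_preimage, Set.uIcc_of_le hT.le] at this
      exact this.1)
  simp only [smul_eq_mul] at hrect
  have e1 : ‖∫ x : ℝ in (0 : ℝ)..T, f (x + (-T : ℝ) * Complex.I)‖ ≤ K / T ^ 2 * |T - 0| := by
    refine intervalIntegral.norm_integral_le_of_norm_le_const fun x hx => ?_
    rw [Set.uIoc_of_le hT.le] at hx
    refine hb _ (by simpa using hx.1.le) ?_
    simpa [abs_of_pos hT] using Complex.abs_im_le_norm (x + (-T : ℝ) * Complex.I)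
  have e2 : ‖∫ x : ℝ in (0 : ℝ)..T, f (x + (T : ℝ) * Complex.I)‖ ≤ K / T ^ 2 * |T - 0| := by
    refine intervalIntegral.norm_integral_le_of_norm_le_const fun x hx => ?_
    rw [Set.uIoc_of_le hT.le] at hx
    refine hb _ (by simpa using hx.1.le) ?_
    simpa [abs_of_pos hT] using Complex.abs_im_le_norm (x + (T : ℝ) * Complex.I)
  have e3 : ‖∫ y : ℝ in (-T)..T, f ((T : ℝ) + y * Complex.I)‖ ≤ K / T ^ 2 * |T - -T| := by
    refine intervalIntegral.norm_integral_le_of_norm_le_const fun y _ => ?_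
    refine hb _ (by simpa using hT.le) ?_
    simpa [abs_of_pos hT] using Complex.abs_re_le_norm ((T : ℝ) + y * Complex.I)
  have e4 : Complex.I * ∫ y : ℝ in (-T)..T, f (y * Complex.I)
      = (∫ x : ℝ in (0 : ℝ)..T, f (x + (-T : ℝ) * Complex.I))
        - (∫ x : ℝ in (0 : ℝ)..T, f (x + (T : ℝ) * Complex.I))
        + Complex.I * ∫ y : ℝ in (-T)..T, f ((T : ℝ) + y * Complex.I) := by
    simp only [Complex.ofReal_zero, zero_add] at hrect
    exact (sub_eq_zero.1 hrect).symm
  have e5 : ‖∫ y : ℝ in (-T)..T, f (y * Complex.I)‖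
      = ‖Complex.I * ∫ y : ℝ in (-T)..T, f (y * Complex.I)‖ := by simp
  change ‖∫ y : ℝ in (-T)..T, f (y * Complex.I)‖ ≤ _
  rw [e5, e4]
  refine (norm_add_le _ _).trans ((add_le_add (norm_sub_le _ _) le_rfl).trans ?_)
  rw [norm_mul, Complex.norm_I, one_mul]
  rw [sub_zero, abs_of_pos hT] at e1 e2
  rw [sub_neg_eq_add, abs_of_pos (by linarith)] at e3
  calc _ ≤ K / T ^ 2 * T + K / T ^ 2 * T + K / T ^ 2 * (T + T) := by gcongr
    _ = 4 * K * T⁻¹ := by field_simp; ring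

end Axis

/-! ### Axis integrals of resolvents and of their products. -/

section ResIntegral

open scoped Matrix.Norms.Operator

variable {n : ℕ} {A D : Matrix (Fin n) (Fin n) ℂ}

theorem hurwitz_neg_one : Hurwitz (-1 : Matrix (Fin n) (Fin n) ℂ) := by
  intro z hz
  by_contra h
  push Not at h
  refine (not_mem_spectrum_iff.2 ?_) hz
  have hz1 : z + 1 ≠ 0 := fun h0 => by
    have := congrArg Complex.re h0
    simp at this
    linarith
  have : z • (1 : Matrix (Fin n) (Fin n) ℂ) - -1 = (z + 1) • 1 := by
    rw [sub_neg_eq_add, add_smul, one_smul]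
  rw [this, Matrix.isUnit_iff_isUnit_det, Matrix.det_smul, Matrix.det_one, mul_one]
  exact (isUnit_iff_ne_zero.2 hz1).pow _

theorem res_neg_one (s : ℂ) (hs : 0 ≤ s.re) :
    res (-1 : Matrix (Fin n) (Fin n) ℂ) s = (1 + s)⁻¹ • 1 := by
  have hz1 : 1 + s ≠ 0 := fun h0 => by
    have := congrArg Complex.re h0
    simp at this
    linarith
  refine Matrix.inv_eq_left_inv ?_
  have : s • (1 : Matrix (Fin n) (Fin n) ℂ) - -1 = (1 + s) • 1 := by
    rw [sub_neg_eq_add, add_smul, one_smul, add_comm]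
  rw [this, Matrix.smul_mul, Matrix.mul_smul, Matrix.one_mul, smul_smul, inv_mul_cancel₀ hz1,
    one_smul]

theorem res_sub_res {s : ℂ} (hA : IsUnit (s • (1 : Matrix (Fin n) (Fin n) ℂ) - A))
    (hD : IsUnit (s • (1 : Matrix (Fin n) (Fin n) ℂ) - D)) :
    res A s - res D s = res A s * (A - D) * res D s := by
  have : A - D = (s • 1 - D) - (s • 1 - A) := by abel
  rw [this, Matrix.mul_sub, res_mul hA, Matrix.sub_mul, Matrix.mul_assoc, mul_res hD,
    Matrix.mul_one, Matrix.one_mul]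

theorem norm_entry_le {k : ℕ} (X : Matrix (Fin n) (Fin k) ℂ) (i : Fin n) (j : Fin k) :
    ‖X i j‖ ≤ ‖X‖ := by
  have h1 : ‖X i j‖₊ ≤ ∑ j, ‖X i j‖₊ :=
    Finset.single_le_sum (f := fun j => ‖X i j‖₊) (fun _ _ => zero_le) (Finset.mem_univ j)
  have h2 : ∑ j, ‖X i j‖₊ ≤ ‖X‖₊ := by
    rw [Matrix.linfty_opNNNorm_def]
    exact Finset.le_sup (f := fun i => ∑ j, ‖X i j‖₊) (Finset.mem_univ i)
  exact_mod_cast h1.trans h2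

theorem norm_trace_mul_le (N X : Matrix (Fin n) (Fin n) ℂ) :
    ‖(N * X).trace‖ ≤ (∑ i, ∑ j, ‖N i j‖) * ‖X‖ := by
  simp only [Matrix.trace, Matrix.diag, Matrix.mul_apply, Finset.sum_mul]
  refine (norm_sum_le _ _).trans (Finset.sum_le_sum fun i _ => ?_)
  refine (norm_sum_le _ _).trans (Finset.sum_le_sum fun j _ => ?_)
  rw [norm_mul]
  gcongr
  exact norm_entry_le X j i

/-- Two resolvents together supply the 1/|s|² decay that Cauchy's theorem on the half-plane
requires. -/
theorem exists_bound_trace_res_mul_res (hA : Hurwitz A) (hD : Hurwitz D)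
    (N M : Matrix (Fin n) (Fin n) ℂ) :
    (∀ s : ℂ, 0 ≤ s.re →
      DifferentiableAt ℂ (fun s => (N * (res A s * M * res D s)).trace) s) ∧
    ∃ K : ℝ, ∀ s : ℂ, 0 ≤ s.re →
      ‖(N * (res A s * M * res D s)).trace‖ ≤ K / (1 + ‖s‖) ^ 2 := by
  constructor
  · intro s hs
    let φ : Matrix (Fin n) (Fin n) ℂ →L[ℂ] ℂ := LinearMap.toContinuousLinearMap
      ((Matrix.traceLinearMap (Fin n) ℂ ℂ).comp (LinearMap.mulLeft ℂ N))
    have h1 := hA.differentiableAt_res hs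
    have h2 := hD.differentiableAt_res hs
    exact φ.differentiableAt.comp s ((h1.mul_const M).mul h2)
  · obtain ⟨K, hK0, hK⟩ := hA.exists_norm_res_le
    obtain ⟨L, hL0, hL⟩ := hD.exists_norm_res_le
    set c := ∑ i, ∑ j, ‖N i j‖ with hc
    have hc0 : 0 ≤ c := by positivity
    refine ⟨c * (K * ‖M‖ * L), fun s hs => ?_⟩
    have hs0 : 0 < 1 + ‖s‖ := by positivity
    have h1 : ‖res A s * M * res D s‖ ≤ K / (1 + ‖s‖) * ‖M‖ * (L / (1 + ‖s‖)) := by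
      refine (norm_mul_le _ _).trans (mul_le_mul ((norm_mul_le _ _).trans ?_) (hL s hs)
        (norm_nonneg _) (by positivity))
      exact mul_le_mul_of_nonneg_right (hK s hs) (norm_nonneg _)
    calc _ ≤ c * ‖res A s * M * res D s‖ := norm_trace_mul_le _ _
      _ ≤ c * (K / (1 + ‖s‖) * ‖M‖ * (L / (1 + ‖s‖))) := mul_le_mul_of_nonneg_left h1 hc0
      _ = _ := by field_simp

theorem integral_trace_res_mul_res (hA : Hurwitz A) (hD : Hurwitz D)
    (N M : Matrix (Fin n) (Fin n) ℂ) :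
    Integrable (fun ω : ℝ =>
      (N * (res A (ω * Complex.I) * M * res D (ω * Complex.I))).trace) ∧
    ∫ ω : ℝ, (N * (res A (ω * Complex.I) * M * res D (ω * Complex.I))).trace = 0 := by
  obtain ⟨h1, K, h2⟩ := exists_bound_trace_res_mul_res hA hD N M
  exact ⟨integrable_axis_of_bound h1 h2, integral_axis_eq_zero h1 h2⟩

/-- A single resolvent decays too slowly to be integrable. Subtracting the resolvent of -I, which
has the same leading term at infinity, leaves a product of two resolvents by the resolvent identity.
-/
theorem integral_trace_res_sub (hA : Hurwitz A) (N : Matrix (Fin n) (Fin n) ℂ) :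
    Integrable (fun ω : ℝ =>
      (N * res A (ω * Complex.I)).trace - (1 + ω * Complex.I)⁻¹ * N.trace) ∧
    ∫ ω : ℝ, ((N * res A (ω * Complex.I)).trace - (1 + ω * Complex.I)⁻¹ * N.trace) = 0 := by
  have h := integral_trace_res_mul_res hA hurwitz_neg_one N (A - -1)
  have : ∀ ω : ℝ, (N * res A (ω * Complex.I)).trace - (1 + ω * Complex.I)⁻¹ * N.trace
      = (N * (res A (ω * Complex.I) * (A - -1) * res (-1) (ω * Complex.I))).trace := by
    intro ω
    rw [← res_sub_res (hA.isUnit (by simp)) (hurwitz_neg_one.isUnit (by simp)),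
      res_neg_one _ (by simp), Matrix.mul_sub, Matrix.trace_sub]
    simp
  simp only [this]
  exact h

/-- The subtracted reference terms at iω and -iω add up to 2/(1 + ω²); this is the source of the
factor 2π. -/
theorem integral_inv_one_add_mul_I :
    Integrable (fun ω : ℝ => (1 + ω * Complex.I)⁻¹ + (1 + ((-ω : ℝ) : ℂ) * Complex.I)⁻¹) ∧
    ∫ ω : ℝ, ((1 + ω * Complex.I)⁻¹ + (1 + ((-ω : ℝ) : ℂ) * Complex.I)⁻¹)
      = ((2 * Real.pi : ℝ) : ℂ) := by
  have h : ∀ ω : ℝ, (1 + ω * Complex.I)⁻¹ + (1 + ((-ω : ℝ) : ℂ) * Complex.I)⁻¹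
      = ((2 * (1 + ω ^ 2)⁻¹ : ℝ) : ℂ) := by
    intro ω
    have h1 : (1 : ℂ) + ω * Complex.I ≠ 0 := fun h0 => by simpa using congrArg Complex.re h0
    have h2 : (1 : ℂ) + ((-ω : ℝ) : ℂ) * Complex.I ≠ 0 := fun h0 => by
      simpa using congrArg Complex.re h0
    have h3 : (1 : ℂ) + ω ^ 2 ≠ 0 := by
      have : (0 : ℝ) < 1 + ω ^ 2 := by positivity
      exact_mod_cast this.ne'
    have h4 : (1 + ω * Complex.I) * (1 + ((-ω : ℝ) : ℂ) * Complex.I) = 1 + (ω : ℂ) ^ 2 := by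
      push_cast
      linear_combination (-(ω : ℂ) ^ 2) * Complex.I_sq
    rw [inv_add_inv h1 h2, h4]
    push_cast
    rw [div_eq_mul_inv]
    ring
  simp only [h]
  refine ⟨(integrable_inv_one_add_sq.const_mul 2).ofReal, ?_⟩
  rw [integral_complex_ofReal, integral_const_mul, integral_univ_inv_one_add_sq]

end ResIntegral

/-! ### Pairing of tangent directions with transfer functions. -/

section InnerFormula

open scoped Matrix

variable {r n m p : ℕ}

/-- The integral of a product of transfer functions in terms of the solutions of the Sylvester
equations. -/
theorem integral_trace_tangent {A : Matrix (Fin r) (Fin r) ℂ} {B : Matrix (Fin r) (Fin m) ℂ}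
    {C : Matrix (Fin p) (Fin r) ℂ} {A' : Matrix (Fin n) (Fin n) ℂ} {B' : Matrix (Fin n) (Fin m) ℂ}
    {C' : Matrix (Fin p) (Fin n) ℂ} (hA : Hurwitz A) (hA' : Hurwitz A')
    {P : Matrix (Fin n) (Fin r) ℂ} {S : Matrix (Fin r) (Fin n) ℂ}
    (hP : A' * P + P * Aᴴ + B' * Bᴴ = 0) (hS : S * A' + Aᴴ * S + Cᴴ * C' = 0)
    (Z : Matrix (Fin r) (Fin r) ℂ) (X : Matrix (Fin r) (Fin m) ℂ) (Y : Matrix (Fin p) (Fin r) ℂ) :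
    ∫ ω : ℝ, ((C * res A (ω * Complex.I) * Z * res A (ω * Complex.I) * B
        + Y * res A (ω * Complex.I) * B + C * res A (ω * Complex.I) * X)ᴴ
        * (C' * res A' (ω * Complex.I) * B')).trace
      = ((2 * Real.pi : ℝ) : ℂ) *
        ((Zᴴ * (S * P)).trace + (Yᴴ * (C' * P)).trace + (Xᴴ * (S * B')).trace) := by
  set τ := (Zᴴ * (S * P)).trace + (Yᴴ * (C' * P)).trace + (Xᴴ * (S * B')).trace with hτ
  -- Partial fractions split the integrand into resolvents of Aᴴ at -iω and of A' at iω, with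
  -- coefficients N₁ and N₂. Both have trace τ by cyclicity, so the slowly decaying parts combine
  -- into τ · 2/(1 + ω²).
  let N₁ : Matrix (Fin r) (Fin r) ℂ := Zᴴ * (S * P) + Yᴴ * (C' * P) + S * B' * Xᴴ
  let N₂ : Matrix (Fin n) (Fin n) ℂ := P * Zᴴ * S + P * Yᴴ * C' + B' * Xᴴ * S
  have hN₁ : N₁.trace = τ := by
    simp only [N₁, hτ, Matrix.trace_add]
    rw [Matrix.trace_mul_comm (S * B') Xᴴ]
  have hN₂ : N₂.trace = τ := by
    simp only [N₂, hτ, Matrix.trace_add]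
    rw [Matrix.mul_assoc P, Matrix.mul_assoc P, Matrix.mul_assoc B', Matrix.trace_mul_comm P,
      Matrix.trace_mul_comm P, Matrix.trace_mul_comm B']
    simp only [Matrix.mul_assoc]
  have hstar : ∀ ω : ℝ, (res A (ω * Complex.I))ᴴ = res Aᴴ ((-ω : ℝ) * Complex.I) := by
    intro ω
    rw [conjTranspose_res]
    congr 1
    simp
  obtain ⟨i1, z1⟩ := integral_trace_res_mul_res hA.conjTranspose hA.conjTranspose Zᴴ (S * B' * Bᴴ)
  obtain ⟨i2, z2⟩ := integral_trace_res_sub hA.conjTranspose N₁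
  obtain ⟨i3, z3⟩ := integral_trace_res_sub hA' N₂
  obtain ⟨i4, z4⟩ := integral_inv_one_add_mul_I
  rw [← integral_neg_eq_self] at z1 z2
  replace i1 := i1.comp_neg
  replace i2 := i2.comp_neg
  have hpt : ∀ ω : ℝ, ((C * res A (ω * Complex.I) * Z * res A (ω * Complex.I) * B
        + Y * res A (ω * Complex.I) * B + C * res A (ω * Complex.I) * X)ᴴ
        * (C' * res A' (ω * Complex.I) * B')).trace
      = (Zᴴ * (res Aᴴ ((-ω : ℝ) * Complex.I) * (S * B' * Bᴴ) * res Aᴴ ((-ω : ℝ) * Complex.I))).trace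
        + ((N₁ * res Aᴴ ((-ω : ℝ) * Complex.I)).trace
            - (1 + ((-ω : ℝ) : ℂ) * Complex.I)⁻¹ * N₁.trace)
        + ((N₂ * res A' (ω * Complex.I)).trace - (1 + ω * Complex.I)⁻¹ * N₂.trace)
        + τ * ((1 + ω * Complex.I)⁻¹ + (1 + ((-ω : ℝ) : ℂ) * Complex.I)⁻¹) := by
    intro ω
    have hu1 := hA'.isUnit (s := ω * Complex.I) (by simp)
    have hu2 := hA.conjTranspose.isUnit (s := (-ω : ℝ) * Complex.I) (by simp)
    have hs : (((-ω : ℝ) : ℂ) * Complex.I) = -(ω * Complex.I) := by push_cast; ring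
    have a1 := mul_res hu1
    have a2 := res_mul hu1
    have a3 := mul_res hu2
    have a4 := res_mul hu2
    simp only [Matrix.conjTranspose_add, Matrix.conjTranspose_mul, hstar]
    generalize res Aᴴ ((-ω : ℝ) * Complex.I) = R at *
    generalize res A' (ω * Complex.I) = R' at *
    rw [hs] at a3 a4
    generalize (ω * Complex.I : ℂ) = s at *
    -- The Sylvester equation in resolvent form: adding and subtracting sP writes B'Bᴴ as (s - A')P
    -- + P(-s - Aᴴ), and each bracket cancels one resolvent.
    have k1 : R' * (B' * Bᴴ) * R = P * R + R' * P := by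
      have : B' * Bᴴ = (s • 1 - A') * P + P * ((-s) • 1 - Aᴴ) := by
        rw [eq_neg_of_add_eq_zero_right hP]
        simp only [Matrix.sub_mul, Matrix.mul_sub, Matrix.smul_mul, Matrix.mul_smul,
          Matrix.one_mul, Matrix.mul_one]
        module
      rw [this, Matrix.mul_add, Matrix.add_mul, ← Matrix.mul_assoc, a2, Matrix.one_mul,
        Matrix.mul_assoc R', Matrix.mul_assoc P, a3, Matrix.mul_one]
    have k2 : R * (Cᴴ * C') * R' = R * S + S * R' := by
      have : Cᴴ * C' = S * (s • 1 - A') + ((-s) • 1 - Aᴴ) * S := by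
        rw [eq_neg_of_add_eq_zero_right hS]
        simp only [Matrix.sub_mul, Matrix.mul_sub, Matrix.smul_mul, Matrix.mul_smul,
          Matrix.one_mul, Matrix.mul_one]
        module
      rw [this, Matrix.mul_add, Matrix.add_mul, Matrix.mul_assoc R, Matrix.mul_assoc S, a1,
        Matrix.mul_one, ← Matrix.mul_assoc R, a4, Matrix.one_mul]
    -- Splitting first by `k2` and then by `k1` leaves one term with two factors R and none R'; its
    -- integral vanishes by Cauchy's theorem.
    have t1 : ((Bᴴ * (R * (Zᴴ * (R * Cᴴ)))) * (C' * R' * B')).trace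
        = (Zᴴ * (R * (S * B' * Bᴴ) * R)).trace + (Zᴴ * (S * P) * R).trace
          + (P * Zᴴ * S * R').trace := by
      have : (Bᴴ * (R * (Zᴴ * (R * Cᴴ)))) * (C' * R' * B')
          = (Bᴴ * R) * (Zᴴ * (R * (Cᴴ * C') * R') * B') := by simp only [Matrix.mul_assoc]
      rw [this, Matrix.trace_mul_comm, k2]
      have : Zᴴ * (R * S + S * R') * B' * (Bᴴ * R)
          = Zᴴ * (R * (S * B' * Bᴴ) * R) + Zᴴ * S * (R' * (B' * Bᴴ) * R) := by
        simp only [Matrix.mul_add, Matrix.add_mul, Matrix.mul_assoc]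
      rw [this, k1, Matrix.mul_add, Matrix.trace_add, Matrix.trace_add, ← add_assoc]
      congr 1
      · simp only [Matrix.mul_assoc]
      · rw [← Matrix.mul_assoc, Matrix.trace_mul_comm]
        simp only [Matrix.mul_assoc]
    have t2 : ((Bᴴ * (R * Yᴴ)) * (C' * R' * B')).trace
        = (Yᴴ * (C' * P) * R).trace + (P * Yᴴ * C' * R').trace := by
      have : (Bᴴ * (R * Yᴴ)) * (C' * R' * B')
          = (Bᴴ * R) * (Yᴴ * C' * R' * B') := by simp only [Matrix.mul_assoc]
      rw [this, Matrix.trace_mul_comm]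
      have : Yᴴ * C' * R' * B' * (Bᴴ * R) = Yᴴ * C' * (R' * (B' * Bᴴ) * R) := by
        simp only [Matrix.mul_assoc]
      rw [this, k1, Matrix.mul_add, Matrix.trace_add]
      congr 1
      · simp only [Matrix.mul_assoc]
      · rw [← Matrix.mul_assoc, Matrix.trace_mul_comm]
        simp only [Matrix.mul_assoc]
    have t3 : ((Xᴴ * (R * Cᴴ)) * (C' * R' * B')).trace
        = (S * B' * Xᴴ * R).trace + (B' * Xᴴ * S * R').trace := by
      have : (Xᴴ * (R * Cᴴ)) * (C' * R' * B')
          = Xᴴ * (R * (Cᴴ * C') * R') * B' := by simp only [Matrix.mul_assoc]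
      rw [this, k2, Matrix.mul_add, Matrix.add_mul, Matrix.trace_add]
      congr 1
      · rw [← Matrix.mul_assoc, Matrix.mul_assoc _ S, Matrix.trace_mul_comm, ← Matrix.mul_assoc]
      · rw [Matrix.trace_mul_comm]
        simp only [Matrix.mul_assoc]
    rw [hN₁, hN₂, Matrix.add_mul, Matrix.add_mul, Matrix.trace_add, Matrix.trace_add,
      t1, t2, t3]
    simp only [N₁, N₂, Matrix.add_mul, Matrix.trace_add]
    ring
  simp only [hpt]
  have i12 := i1.add i2
  have i123 := i12.add i3
  simp only [Pi.add_def] at i12 i123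
  rw [integral_add i123 (i4.const_mul τ), integral_add i12 i3,
    integral_add i1 i2, z1, z2, z3, integral_const_mul, z4]
  ring

end InnerFormula

/-! ### Boundary values -/

section Boundary

open scoped Matrix

variable {p m : ℕ}

theorem ae_axisMeasure {P : ℝ → Prop} (h : ∀ᵐ x : ℝ, P x) : ∀ᵐ x ∂axisMeasure, P x :=
  Measure.smul_absolutelyContinuous.ae_le h

theorem inner_toVal (M N : Matrix (Fin p) (Fin m) ℂ) :
    inner ℂ (toVal M) (toVal N) = (Mᴴ * N).trace := by
  rw [PiLp.inner_apply, Fintype.sum_prod_type_right]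
  simp only [Matrix.trace, Matrix.diag, Matrix.mul_apply, toVal, RCLike.inner_apply,
    Matrix.conjTranspose_apply]
  refine Finset.sum_congr rfl fun i _ => Finset.sum_congr rfl fun j _ => ?_
  rw [mul_comm]
  rfl

theorem inner_eq_integral_trace {u v : HardySpace p m} {M N : ℝ → Matrix (Fin p) (Fin m) ℂ}
    (hu : ∀ᵐ ω : ℝ, (u : Lp (Val p m) 2 axisMeasure) ω = toVal (M ω))
    (hv : ∀ᵐ ω : ℝ, (v : Lp (Val p m) 2 axisMeasure) ω = toVal (N ω)) :
    inner ℂ u v = (((2 * Real.pi)⁻¹ : ℝ) : ℂ) * ∫ ω : ℝ, ((M ω)ᴴ * N ω).trace := by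
  rw [Submodule.coe_inner, L2.inner_def]
  have : ∫ ω, inner ℂ ((u : Lp (Val p m) 2 axisMeasure) ω) ((v : Lp (Val p m) 2 axisMeasure) ω)
      ∂axisMeasure = ∫ ω, ((M ω)ᴴ * N ω).trace ∂axisMeasure := by
    refine integral_congr_ae ?_
    filter_upwards [ae_axisMeasure hu, ae_axisMeasure hv] with ω h1 h2
    rw [h1, h2, inner_toVal]
  rw [this, axisMeasure, integral_smul_measure, ENNReal.toReal_ofReal (by positivity),
    one_div, Complex.real_smul]

theorem continuous_toVal :
    Continuous (toVal : Matrix (Fin p) (Fin m) ℂ → Val p m) := by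
  unfold toVal
  fun_prop

theorem Hurwitz.continuousAt_res {n : ℕ} {A : Matrix (Fin n) (Fin n) ℂ} (hA : Hurwitz A) {s : ℂ}
    (hs : 0 ≤ s.re) : ContinuousAt (res A) s := by
  open scoped Matrix.Norms.Operator in
  exact (hA.differentiableAt_res hs).continuousAt

/-- A Hurwitz resolvent is continuous up to the axis, so the almost everywhere limits are its actual
values there. -/
theorem HasTransfer.ae_eq {𝕜 : Type*} [RCLike 𝕜] {n : ℕ} {G : HardySpace p m}
    {A : Matrix (Fin n) (Fin n) 𝕜} {B : Matrix (Fin n) (Fin m) 𝕜} {C : Matrix (Fin p) (Fin n) 𝕜}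
    (hG : HasTransfer G 1 A B C) (hA : Hurwitz (cplx A)) :
    ∀ᵐ ω : ℝ, (G : Lp (Val p m) 2 axisMeasure) ω
      = toVal (cplx C * res (cplx A) (ω * Complex.I) * cplx B) := by
  filter_upwards [hG.2.2] with ω hω
  refine tendsto_nhds_unique hω ?_
  simp only [transfer_one]
  have h1 : ContinuousAt (fun s => toVal (cplx C * res (cplx A) s * cplx B)) (ω * Complex.I) := by
    have hc : Continuous fun X : Matrix (Fin n) (Fin n) ℂ => toVal (cplx C * X * cplx B) :=
      continuous_toVal.comp (by fun_prop)
    exact hc.continuousAt.comp (hA.continuousAt_res (by simp))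
  have h2 : Tendsto (fun ξ : ℝ => (ξ + ω * Complex.I : ℂ)) (𝓝[>] 0) (𝓝 (ω * Complex.I)) := by
    have : Continuous fun ξ : ℝ => (ξ + ω * Complex.I : ℂ) := by fun_prop
    simpa using (this.tendsto 0).mono_left nhdsWithin_le_nhds
  exact h1.tendsto.comp h2

theorem transfer_eq_transfer_one {𝕜 : Type*} [RCLike 𝕜] {n : ℕ} {E : Matrix (Fin n) (Fin n) 𝕜}
    (hE : IsUnit E) (A : Matrix (Fin n) (Fin n) 𝕜) (B : Matrix (Fin n) (Fin m) 𝕜)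
    (C : Matrix (Fin p) (Fin n) 𝕜) :
    transfer E A B C = transfer 1 (E⁻¹ * A) (E⁻¹ * B) C := by
  funext s
  have hE' : IsUnit (cplx E).det := (Matrix.isUnit_iff_isUnit_det _).1 (isUnit_cplx_iff.2 hE)
  have h1 : s • cplx E - cplx A = cplx E * (s • 1 - cplx (E⁻¹ * A)) := by
    rw [Matrix.mul_sub, cplx_mul, cplx_inv, ← Matrix.mul_assoc, Matrix.mul_nonsing_inv _ hE',
      Matrix.one_mul, Matrix.mul_smul, Matrix.mul_one]
  rw [transfer_one, transfer, h1, Matrix.mul_inv_rev, res, cplx_mul E⁻¹ B, cplx_inv]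
  simp only [Matrix.mul_assoc]

theorem hasTransfer_iff_one {𝕜 : Type*} [RCLike 𝕜] {n : ℕ} {E : Matrix (Fin n) (Fin n) 𝕜}
    (hE : IsUnit E) {A : Matrix (Fin n) (Fin n) 𝕜} {B : Matrix (Fin n) (Fin m) 𝕜}
    {C : Matrix (Fin p) (Fin n) 𝕜} {G : HardySpace p m} :
    HasTransfer G E A B C ↔ HasTransfer G 1 (E⁻¹ * A) (E⁻¹ * B) C := by
  rw [HasTransfer, HasTransfer, transfer_eq_transfer_one hE]

end Boundary

/-! ### Elements of the Hardy space given by functions that decay like `1 / |s|` -/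

section Decay

variable {p m : ℕ}

/-- `F` is continuous on the closed right half-plane, analytic on the open one, and `O(1 / |s|)`. -/
structure DecayingAnalytic (F : ℂ → Val p m) : Prop where
  continuousOn : ContinuousOn F {s : ℂ | 0 ≤ s.re}
  differentiableOn : DifferentiableOn ℂ F {s : ℂ | 0 < s.re}
  bound : ∃ K : ℝ, ∀ s : ℂ, 0 ≤ s.re → ‖F s‖ ≤ K / (1 + ‖s‖)

theorem div_sq_le_inv_one_add_sq {K x y : ℝ} (hxy : |x| ≤ y) :
    (K / (1 + y)) ^ 2 ≤ K ^ 2 * (1 + x ^ 2)⁻¹ := by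
  rw [div_pow, div_eq_mul_inv]
  gcongr
  nlinarith [sq_abs x, abs_nonneg x]

theorem memLp_inv_one_add_abs : MemLp (fun ω : ℝ => 1 / (1 + |ω|)) 2 axisMeasure := by
  have hc : Continuous fun ω : ℝ => 1 / (1 + |ω|) :=
    continuous_const.div (by fun_prop) fun ω => by positivity
  rw [memLp_two_iff_integrable_sq hc.aestronglyMeasurable, axisMeasure]
  refine Integrable.smul_measure ?_ ENNReal.ofReal_ne_top
  refine integrable_inv_one_add_sq.mono' (hc.pow 2).aestronglyMeasurable
    (Eventually.of_forall fun ω => ?_)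
  rw [Real.norm_of_nonneg (by positivity)]
  simpa using div_sq_le_inv_one_add_sq (K := 1) (le_refl |ω|)

theorem norm_ofReal_mul_I (ω : ℝ) : ‖(ω * Complex.I : ℂ)‖ = |ω| := by simp

variable {F : ℂ → Val p m}

theorem DecayingAnalytic.memLp (h : DecayingAnalytic F) :
    MemLp (fun ω : ℝ => F (ω * Complex.I)) 2 axisMeasure := by
  have hc : Continuous fun ω : ℝ => F (ω * Complex.I) := by
    rw [← continuousOn_univ]
    exact h.continuousOn.comp (by fun_prop) fun ω _ => by simp
  obtain ⟨K, hK⟩ := h.bound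
  refine memLp_inv_one_add_abs.of_le_mul (c := K) hc.aestronglyMeasurable
    (Eventually.of_forall fun ω => ?_)
  refine (hK _ (by simp)).trans (le_of_eq ?_)
  rw [norm_ofReal_mul_I, Real.norm_of_nonneg (by positivity), mul_one_div]

theorem DecayingAnalytic.isHardyExtension (h : DecayingAnalytic F) :
    IsHardyExtension F fun ω : ℝ => F (ω * Complex.I) := by
  obtain ⟨K, hK⟩ := h.bound
  refine ⟨h.differentiableOn, ?_, Eventually.of_forall fun ω => ?_⟩
  · have hfin : ∫⁻ ω : ℝ, ENNReal.ofReal (K ^ 2 * (1 + ω ^ 2)⁻¹) ≠ ∞ :=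
      (integrable_inv_one_add_sq.const_mul (K ^ 2)).lintegral_lt_top.ne
    refine ⟨(∫⁻ ω : ℝ, ENNReal.ofReal (K ^ 2 * (1 + ω ^ 2)⁻¹)).toNNReal, fun ξ hξ => ?_⟩
    rw [ENNReal.coe_toNNReal hfin]
    refine lintegral_mono fun ω => ?_
    rw [← ofReal_norm, ← ENNReal.ofReal_pow (norm_nonneg _)]
    refine ENNReal.ofReal_le_ofReal ?_
    refine (pow_le_pow_left₀ (norm_nonneg _) (hK _ (by simpa using hξ.le)) 2).trans
      (div_sq_le_inv_one_add_sq ?_)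
    simpa using Complex.abs_im_le_norm (ξ + ω * Complex.I)
  · have h1 : ContinuousWithinAt F {s : ℂ | 0 ≤ s.re} (ω * Complex.I) :=
      h.continuousOn _ (by simp)
    refine h1.tendsto.comp (tendsto_nhdsWithin_iff.2 ⟨?_, ?_⟩)
    · have : Continuous fun ξ : ℝ => (ξ + ω * Complex.I : ℂ) := by fun_prop
      simpa using (this.tendsto 0).mono_left nhdsWithin_le_nhds
    · filter_upwards [self_mem_nhdsWithin] with ξ hξ
      simpa using (le_of_lt hξ : (0 : ℝ) ≤ ξ)

/-- The element of the Hardy space with analytic extension `F`. -/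
noncomputable def DecayingAnalytic.toHardy (h : DecayingAnalytic F) : HardySpace p m :=
  ⟨h.memLp.toLp _, F, h.isHardyExtension.congr h.memLp.coeFn_toLp.symm⟩

theorem DecayingAnalytic.isHardyExtension_toHardy (h : DecayingAnalytic F) :
    IsHardyExtension F (h.toHardy : Lp (Val p m) 2 axisMeasure) :=
  h.isHardyExtension.congr h.memLp.coeFn_toLp.symm

theorem DecayingAnalytic.toHardy_ae (h : DecayingAnalytic F) :
    ∀ᵐ ω : ℝ, (h.toHardy : Lp (Val p m) 2 axisMeasure) ω = F (ω * Complex.I) :=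
  axisMeasure_ae h.memLp.coeFn_toLp

/-- The bound is linear in the decay constant, which makes `hardyMul` a bounded operator. -/
theorem DecayingAnalytic.norm_toHardy_le (h : DecayingAnalytic F) {K : ℝ}
    (hK : ∀ s : ℂ, 0 ≤ s.re → ‖F s‖ ≤ K / (1 + ‖s‖)) :
    ‖h.toHardy‖ ≤ K * ‖memLp_inv_one_add_abs.toLp _‖ := by
  rw [Submodule.coe_norm]
  refine Lp.norm_le_mul_norm_of_ae_le_mul ?_
  filter_upwards [h.memLp.coeFn_toLp, memLp_inv_one_add_abs.coeFn_toLp] with ω h1 h2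
  rw [h2]
  change ‖(h.memLp.toLp _ : Lp (Val p m) 2 axisMeasure) ω‖ ≤ _
  rw [h1]
  refine (hK _ (by simp)).trans (le_of_eq ?_)
  rw [norm_ofReal_mul_I, Real.norm_of_nonneg (by positivity), mul_one_div]

/-- The boundary function of `u` is `g`. -/
def HasBoundary (u : HardySpace p m) (g : ℝ → Val p m) : Prop :=
  ∀ᵐ ω : ℝ, (u : Lp (Val p m) 2 axisMeasure) ω = g ω

theorem HasBoundary.add {u v : HardySpace p m} {g k : ℝ → Val p m} (hu : HasBoundary u g)
    (hv : HasBoundary v k) : HasBoundary (u + v) (fun ω => g ω + k ω) := by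
  have := axisMeasure_ae (Lp.coeFn_add (u : Lp (Val p m) 2 axisMeasure) v)
  filter_upwards [hu, hv, this] with ω h1 h2 h3
  rw [Submodule.coe_add, h3, Pi.add_apply, h1, h2]

theorem HasBoundary.smul {u : HardySpace p m} {g : ℝ → Val p m} (c : ℂ) (hu : HasBoundary u g) :
    HasBoundary (c • u) (fun ω => c • g ω) := by
  have := axisMeasure_ae (Lp.coeFn_smul c (u : Lp (Val p m) 2 axisMeasure))
  filter_upwards [hu, this] with ω h1 h3
  rw [Submodule.coe_smul, h3, Pi.smul_apply, h1]

theorem HasBoundary.congr {u : HardySpace p m} {g k : ℝ → Val p m} (hu : HasBoundary u g)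
    (h : ∀ ω, g ω = k ω) : HasBoundary u k := by
  filter_upwards [hu] with ω h1
  rw [h1, h]

theorem HasBoundary.unique {u v : HardySpace p m} {g k : ℝ → Val p m} (hu : HasBoundary u g)
    (hv : HasBoundary v k) (h : ∀ ω, g ω = k ω) : u = v := by
  refine Subtype.ext (Lp.ext ?_)
  filter_upwards [ae_axisMeasure hu, ae_axisMeasure hv] with ω h1 h2
  rw [h1, h2, h]

end Decay

/-! ### The algebra of bounded analytic matrix functions -/

section BoundedAnalytic

open scoped Matrix.Norms.Operator BoundedContinuousFunction

/-- Bounded continuous matrix functions that are analytic on the open right half-plane. -/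
def boundedAnalytic (r : ℕ) : Subalgebra ℂ (ℂ →ᵇ Matrix (Fin r) (Fin r) ℂ) where
  carrier := {f | DifferentiableOn ℂ f {s : ℂ | 0 < s.re}}
  mul_mem' := fun {f g} hf hg => by
    have : DifferentiableOn ℂ (fun s => f s * g s) {s : ℂ | 0 < s.re} := hf.mul hg
    exact this
  add_mem' := fun {f g} hf hg => by
    have : DifferentiableOn ℂ (fun s => f s + g s) {s : ℂ | 0 < s.re} := hf.add hg
    exact this
  algebraMap_mem' := fun c => by
    have : DifferentiableOn ℂ (fun _ : ℂ => algebraMap ℂ (Matrix (Fin r) (Fin r) ℂ) c)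
      {s : ℂ | 0 < s.re} := differentiableOn_const _
    exact this

theorem isOpen_rightHalfPlane : IsOpen {s : ℂ | 0 < s.re} :=
  isOpen_lt continuous_const Complex.continuous_re

/-- Uniform limits of analytic functions are analytic. The resulting completeness makes this a
Banach algebra, in which units are open and inversion is smooth. -/
theorem isClosed_boundedAnalytic (r : ℕ) :
    IsClosed (boundedAnalytic r : Set (ℂ →ᵇ Matrix (Fin r) (Fin r) ℂ)) := by
  refine IsSeqClosed.isClosed fun f g hf hg => ?_
  rw [BoundedContinuousFunction.tendsto_iff_tendstoUniformly] at hg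
  have h1 : TendstoLocallyUniformlyOn (fun n => (f n : ℂ → Matrix (Fin r) (Fin r) ℂ)) g atTop
      {s : ℂ | 0 < s.re} := hg.tendstoUniformlyOn.tendstoLocallyUniformlyOn
  exact h1.differentiableOn (Eventually.of_forall fun n => hf n) isOpen_rightHalfPlane

instance (r : ℕ) : CompleteSpace (boundedAnalytic r) :=
  (isClosed_boundedAnalytic r).completeSpace_coe

/-- The retraction of the complex plane onto the closed right half-plane. -/
noncomputable def retract (s : ℂ) : ℂ := (max s.re 0 : ℝ) + s.im * Complex.I

theorem retract_re_nonneg (s : ℂ) : 0 ≤ (retract s).re := by simp [retract]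

theorem retract_eq_self {s : ℂ} (hs : 0 ≤ s.re) : retract s = s := by
  rw [retract, max_eq_left hs, Complex.re_add_im]

theorem continuous_retract : Continuous retract := by
  unfold retract
  fun_prop

variable {r : ℕ} {A : Matrix (Fin r) (Fin r) ℂ}

/-- Precomposing with `retract` makes the resolvent bounded on all of ℂ without changing it on the
closed right half-plane. -/
theorem Hurwitz.exists_norm_res_retract_le (hA : Hurwitz A) :
    ∃ K, ∀ s, ‖res A (retract s)‖ ≤ K := by
  obtain ⟨K, hK0, hK⟩ := hA.exists_norm_res_le
  exact ⟨K, fun s => (hK _ (retract_re_nonneg s)).trans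
    (div_le_self hK0 (by linarith [norm_nonneg (retract s)]))⟩

/-- The resolvent of a Hurwitz matrix as a bounded analytic function. -/
noncomputable def Hurwitz.resAnalytic (hA : Hurwitz A) : boundedAnalytic r :=
  ⟨BoundedContinuousFunction.ofNormedAddCommGroup (fun s => res A (retract s))
    (continuous_iff_continuousAt.2 fun s =>
      (hA.continuousAt_res (retract_re_nonneg s)).comp continuous_retract.continuousAt)
    hA.exists_norm_res_retract_le.choose hA.exists_norm_res_retract_le.choose_spec, by
    have : DifferentiableOn ℂ (res A) {s : ℂ | 0 < s.re} := fun s hs =>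
      (hA.differentiableAt_res (le_of_lt hs)).differentiableWithinAt
    exact this.congr fun s hs => congrArg (res A) (retract_eq_self (le_of_lt hs))⟩

theorem Hurwitz.resAnalytic_apply (hA : Hurwitz A) {s : ℂ} (hs : 0 ≤ s.re) :
    hA.resAnalytic.1 s = res A s :=
  congrArg (res A) (retract_eq_self hs)

/-- A constant matrix as a bounded analytic function. -/
noncomputable def constAnalytic (Z : Matrix (Fin r) (Fin r) ℂ) : boundedAnalytic r :=
  ⟨BoundedContinuousFunction.const ℂ Z, differentiableOn_const Z⟩

variable {p m : ℕ}

/-- The linear map `X ↦ L X M`, with values in `ℂ^{p×m}`. -/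
def toValMul (L : Matrix (Fin p) (Fin r) ℂ) (M : Matrix (Fin r) (Fin m) ℂ) :
    Matrix (Fin r) (Fin r) ℂ →ₗ[ℂ] Val p m where
  toFun X := toVal (L * X * M)
  map_add' X Y := by
    ext ij
    simp [toVal, Matrix.mul_add, Matrix.add_mul]
  map_smul' c X := by
    ext ij
    simp [toVal]

/-- The explicit resolvent provides the decay, so f need only be bounded. -/
theorem exists_norm_toVal_res_mul_le (hA : Hurwitz A) (L : Matrix (Fin p) (Fin r) ℂ)
    (M : Matrix (Fin r) (Fin m) ℂ) :
    ∃ c : ℝ, ∀ (f : boundedAnalytic r) (s : ℂ), 0 ≤ s.re →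
      ‖toVal (L * (res A s * f.1 s) * M)‖ ≤ c * ‖f‖ / (1 + ‖s‖) := by
  obtain ⟨K, hK0, hK⟩ := hA.exists_norm_res_le
  obtain ⟨c, hc0, hc⟩ := (LinearMap.toContinuousLinearMap (toValMul L M)).bound
  refine ⟨c * K, fun f s hs => (hc _).trans ?_⟩
  rw [mul_assoc, mul_div_assoc]
  refine mul_le_mul_of_nonneg_left ((norm_mul_le _ _).trans ?_) hc0.le
  rw [mul_div_right_comm]
  exact mul_le_mul (hK s hs) (f.1.norm_coe_le_norm s) (norm_nonneg _) (by positivity)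

theorem decayingAnalytic_mul (hA : Hurwitz A) (L : Matrix (Fin p) (Fin r) ℂ)
    (M : Matrix (Fin r) (Fin m) ℂ) (f : boundedAnalytic r) :
    DecayingAnalytic fun s => toVal (L * (res A s * f.1 s) * M) where
  continuousOn := by
    have h1 : ContinuousOn (fun s => res A s * f.1 s) {s : ℂ | 0 ≤ s.re} :=
      ContinuousOn.mul (fun s hs => (hA.continuousAt_res hs).continuousWithinAt)
        f.1.continuous.continuousOn
    exact (LinearMap.toContinuousLinearMap (toValMul L M)).continuous.comp_continuousOn h1
  differentiableOn := by
    have h1 : DifferentiableOn ℂ (fun s => res A s * f.1 s) {s : ℂ | 0 < s.re} :=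
      DifferentiableOn.mul (fun s hs =>
        (hA.differentiableAt_res (le_of_lt hs)).differentiableWithinAt) f.2
    exact (LinearMap.toContinuousLinearMap (toValMul L M)).differentiable.comp_differentiableOn h1
  bound := by
    obtain ⟨c, hc⟩ := exists_norm_toVal_res_mul_le hA L M
    exact ⟨c * ‖f‖, hc f⟩

/-- The element of the Hardy space with values `L (sI - A)⁻¹ f(s) M`, as a function of `f`. -/
noncomputable def hardyMul (hA : Hurwitz A) (L : Matrix (Fin p) (Fin r) ℂ)
    (M : Matrix (Fin r) (Fin m) ℂ) : boundedAnalytic r →L[ℂ] HardySpace p m :=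
  LinearMap.mkContinuousOfExistsBound
    { toFun := fun f => (decayingAnalytic_mul hA L M f).toHardy
      map_add' := fun f g => by
        refine HasBoundary.unique (decayingAnalytic_mul hA L M (f + g)).toHardy_ae
          (HasBoundary.add (decayingAnalytic_mul hA L M f).toHardy_ae
            (decayingAnalytic_mul hA L M g).toHardy_ae) fun ω => ?_
        change toValMul L M (_ * (f.1 _ + g.1 _)) = _
        rw [Matrix.mul_add, map_add]
        rfl
      map_smul' := fun c f => by
        refine HasBoundary.unique (decayingAnalytic_mul hA L M (c • f)).toHardy_ae
          (HasBoundary.smul c (decayingAnalytic_mul hA L M f).toHardy_ae) fun ω => ?_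
        change toValMul L M (_ * (c • f.1 _)) = _
        rw [Matrix.mul_smul, map_smul]
        rfl } (by
    obtain ⟨c, hc⟩ := exists_norm_toVal_res_mul_le hA L M
    refine ⟨c * ‖memLp_inv_one_add_abs.toLp _‖, fun f => ?_⟩
    refine ((decayingAnalytic_mul hA L M f).norm_toHardy_le (hc f)).trans (le_of_eq ?_)
    exact mul_right_comm _ _ _)

theorem hardyMul_boundary (hA : Hurwitz A) (L : Matrix (Fin p) (Fin r) ℂ)
    (M : Matrix (Fin r) (Fin m) ℂ) (f : boundedAnalytic r) :
    HasBoundary (hardyMul hA L M f) fun ω =>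
      toVal (L * (res A (ω * Complex.I) * f.1 (ω * Complex.I)) * M) :=
  (decayingAnalytic_mul hA L M f).toHardy_ae

theorem isHardyExtension_hardyMul (hA : Hurwitz A) (L : Matrix (Fin p) (Fin r) ℂ)
    (M : Matrix (Fin r) (Fin m) ℂ) (f : boundedAnalytic r) :
    IsHardyExtension (fun s => toVal (L * (res A s * f.1 s) * M))
      (hardyMul hA L M f : Lp (Val p m) 2 axisMeasure) :=
  (decayingAnalytic_mul hA L M f).isHardyExtension_toHardy

theorem toVal_add (M N : Matrix (Fin p) (Fin m) ℂ) : toVal (M + N) = toVal M + toVal N := rfl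

theorem toVal_smul (c : ℂ) (M : Matrix (Fin p) (Fin m) ℂ) : toVal (c • M) = c • toVal M := rfl

/-- Puts a system whose input and output matrices move linearly in z into the shape of
`inverseCurve`. -/
theorem hardyMul_add_smul (hA : Hurwitz A) (L Y : Matrix (Fin p) (Fin r) ℂ)
    (M X : Matrix (Fin r) (Fin m) ℂ) (z : ℂ) (f : boundedAnalytic r) :
    hardyMul hA (L + z • Y) (M + z • X) f = hardyMul hA L M f
      + z • (hardyMul hA Y M f + hardyMul hA L X f) + z ^ 2 • hardyMul hA Y X f := by
  refine HasBoundary.unique (hardyMul_boundary hA _ _ f)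
    (((hardyMul_boundary hA L M f).add (((hardyMul_boundary hA Y M f).add
      (hardyMul_boundary hA L X f)).smul z)).add ((hardyMul_boundary hA Y X f).smul (z ^ 2)))
    fun ω => ?_
  simp only [← toVal_add, ← toVal_smul]
  congr 1
  simp only [Matrix.add_mul, Matrix.mul_add, Matrix.smul_mul, Matrix.mul_smul]
  module

end BoundedAnalytic

/-! ### Smooth curves -/

section Curve

theorem inverse_one_sub_zero_smul {𝓡 : Type*} [Ring 𝓡] [Algebra ℂ 𝓡] (N : 𝓡) :
    Ring.inverse (1 - ((0 : ℝ) : ℂ) • N) = 1 := by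
  simp

variable {X : Type*} [NormedAddCommGroup X] [InnerProductSpace ℂ X]
  {𝓡 : Type*} [NormedRing 𝓡] [NormedAlgebra ℂ 𝓡] [CompleteSpace 𝓡]

theorem eventually_isUnit_one_sub_smul (N : 𝓡) :
    ∀ᶠ t : ℝ in 𝓝 0, IsUnit (1 - (t : ℂ) • N) := by
  have h : IsOpen {t : ℝ | IsUnit (1 - (t : ℂ) • N)} :=
    Units.isOpen.preimage (f := fun t : ℝ => 1 - (t : ℂ) • N) (by fun_prop)
  exact h.mem_nhds (by simp)

/-- The curve `t ↦ Φ₀ ((1 - tN)⁻¹) + t Φ₁ ((1 - tN)⁻¹) + t² Φ₂ ((1 - tN)⁻¹)`. -/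
noncomputable def inverseCurve (Φ₀ Φ₁ Φ₂ : 𝓡 →L[ℂ] X) (N : 𝓡) (z : ℂ) : X :=
  Φ₀ (Ring.inverse (1 - z • N)) + z • Φ₁ (Ring.inverse (1 - z • N))
    + z ^ 2 • Φ₂ (Ring.inverse (1 - z • N))

theorem contDiffAt_inverseCurve (Φ₀ Φ₁ Φ₂ : 𝓡 →L[ℂ] X) (N : 𝓡) {t : ℝ}
    (ht : IsUnit (1 - (t : ℂ) • N)) :
    ContDiffAt ℝ (⊤ : ℕ∞) (fun t : ℝ => inverseCurve Φ₀ Φ₁ Φ₂ N t) t := by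
  have hV : ContDiffAt ℂ (⊤ : ℕ∞) (fun z : ℂ => Ring.inverse (1 - z • N)) (t : ℂ) := by
    obtain ⟨u, hu⟩ := ht
    have h1 : ContDiffAt ℂ (⊤ : ℕ∞) Ring.inverse (1 - (t : ℂ) • N) := by
      rw [← hu]
      exact contDiffAt_ringInverse ℂ u
    exact h1.comp (f := fun z : ℂ => 1 - z • N) (t : ℂ) (by fun_prop)
  have hc : ContDiffAt ℂ (⊤ : ℕ∞) (inverseCurve Φ₀ Φ₁ Φ₂ N) (t : ℂ) := by
    unfold inverseCurve
    exact ((Φ₀.contDiff.contDiffAt.comp _ hV).add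
      (contDiffAt_id.smul (Φ₁.contDiff.contDiffAt.comp _ hV))).add
      ((contDiffAt_id.pow 2).smul (Φ₂.contDiff.contDiffAt.comp _ hV))
  exact (hc.restrict_scalars ℝ).comp t Complex.ofRealCLM.contDiff.contDiffAt

theorem hasDerivAt_inverseCurve (Φ₀ Φ₁ Φ₂ : 𝓡 →L[ℂ] X) (N : 𝓡) :
    HasDerivAt (fun t : ℝ => inverseCurve Φ₀ Φ₁ Φ₂ N t) (Φ₀ N + Φ₁ 1) 0 := by
  have hV : HasDerivAt (fun z : ℂ => Ring.inverse (1 - z • N)) N 0 := by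
    have h1 : HasFDerivAt Ring.inverse _ (((1 : 𝓡ˣ) : 𝓡)) := hasFDerivAt_ringInverse (𝕜 := ℂ) 1
    have h2 : HasDerivAt (fun z : ℂ => 1 - z • N) (-N) 0 := by
      simpa using ((hasDerivAt_id (0 : ℂ)).smul_const N).const_sub 1
    have h3 : ((1 : 𝓡ˣ) : 𝓡) = 1 - (0 : ℂ) • N := by simp
    rw [h3] at h1
    refine (h1.comp_hasDerivAt (0 : ℂ) h2).congr_deriv ?_
    simp
  have hc : HasDerivAt (inverseCurve Φ₀ Φ₁ Φ₂ N) (Φ₀ N + Φ₁ 1) 0 := by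
    have h0 := Φ₀.hasFDerivAt.comp_hasDerivAt (0 : ℂ) hV
    have h1 := (hasDerivAt_id (0 : ℂ)).smul (Φ₁.hasFDerivAt.comp_hasDerivAt (0 : ℂ) hV)
    have h2 := ((hasDerivAt_id (0 : ℂ)).pow 2).smul (Φ₂.hasFDerivAt.comp_hasDerivAt (0 : ℂ) hV)
    exact ((h0.add h1).add h2).congr_deriv (by simp)
  have h4 : HasDerivAt (fun t : ℝ => (t : ℂ)) 1 0 := Complex.ofRealCLM.hasDerivAt
  have h5 : HasDerivAt (inverseCurve Φ₀ Φ₁ Φ₂ N) (Φ₀ N + Φ₁ 1) ((0 : ℝ) : ℂ) := by simpa using hc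
  exact (h5.scomp (0 : ℝ) h4).congr_deriv (one_smul _ _)

end Curve

/-! ### Tangent vectors of the manifold of stable systems -/

section Tangent

open scoped Matrix.Norms.Operator

variable {r m p : ℕ}

theorem IsHardyExtension.congr_left {F F' : ℂ → Val p m} {u : ℝ → Val p m}
    (h : IsHardyExtension F u) (hF : ∀ s : ℂ, 0 < s.re → F' s = F s) : IsHardyExtension F' u := by
  obtain ⟨h1, ⟨K, hK⟩, h3⟩ := h
  refine ⟨h1.congr hF, ⟨K, fun ξ hξ => ?_⟩, ?_⟩
  · refine le_of_eq_of_le (lintegral_congr fun ω => ?_) (hK ξ hξ)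
    rw [hF _ (by simpa using hξ)]
  · filter_upwards [h3] with ω hω
    refine hω.congr' ?_
    filter_upwards [self_mem_nhdsWithin] with ξ hξ
    exact (hF _ (by simpa using hξ)).symm

/-- Rests on s - (A + zZ) = (1 - zZ(s - A)⁻¹)(s - A). Used at all s of the closed right half-plane
at once, it also shows that A + zZ stays Hurwitz. -/
theorem isUnit_smul_one_sub_add_smul {A Z U : Matrix (Fin r) (Fin r) ℂ} {s z : ℂ}
    (h : IsUnit (s • (1 : Matrix (Fin r) (Fin r) ℂ) - A)) (hU : (1 - z • (Z * res A s)) * U = 1) :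
    IsUnit (s • (1 : Matrix (Fin r) (Fin r) ℂ) - (A + z • Z)) ∧
      res (A + z • Z) s = res A s * U := by
  have h1 : s • (1 : Matrix (Fin r) (Fin r) ℂ) - (A + z • Z)
      = (1 - z • (Z * res A s)) * (s • 1 - A) := by
    rw [Matrix.sub_mul, Matrix.smul_mul, Matrix.mul_assoc Z, res_mul h]
    simp only [Matrix.one_mul, Matrix.mul_one]
    abel
  have h2 : (s • (1 : Matrix (Fin r) (Fin r) ℂ) - (A + z • Z)) * (res A s * U) = 1 := by
    rw [h1, Matrix.mul_assoc, ← Matrix.mul_assoc (s • 1 - A), mul_res h, Matrix.one_mul, hU]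
  refine ⟨?_, Matrix.inv_eq_right_inv h2⟩
  rw [Matrix.isUnit_iff_isUnit_det]
  exact Matrix.isUnit_det_of_right_inverse h2

/-- The curve comes from the systems (A + tZ, B + tX, C + tY). With N = ZR its value is (C + tY) R
(1 - tN)⁻¹ (B + tX), which is smooth in H₂ because inversion is smooth in the Banach algebra of
bounded analytic functions. For small t, invertibility of 1 - tN keeps stability and
`IsMinimal.eventually` keeps minimality. -/
theorem exists_mem_tangentSet {𝕜 : Type*} [RCLike 𝕜] {A : Matrix (Fin r) (Fin r) 𝕜}
    {B : Matrix (Fin r) (Fin m) 𝕜} {C : Matrix (Fin p) (Fin r) 𝕜} (hA : Hurwitz (cplx A))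
    (hmin : IsMinimal A B C) {G : HardySpace p m} (hG : HasTransfer G 1 A B C)
    (Z : Matrix (Fin r) (Fin r) 𝕜) (X : Matrix (Fin r) (Fin m) 𝕜) (Y : Matrix (Fin p) (Fin r) 𝕜) :
    ∃ v ∈ tangentSet (stableManifold 𝕜 r m p) G, HasBoundary v fun ω =>
      toVal (cplx C * res (cplx A) (ω * Complex.I) * cplx Z * res (cplx A) (ω * Complex.I) * cplx B
        + cplx Y * res (cplx A) (ω * Complex.I) * cplx B
        + cplx C * res (cplx A) (ω * Complex.I) * cplx X) := by
  let N : boundedAnalytic r := constAnalytic (cplx Z) * hA.resAnalytic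
  let Φ₀ := hardyMul hA (cplx C) (cplx B)
  let Φ₁ := hardyMul hA (cplx Y) (cplx B) + hardyMul hA (cplx C) (cplx X)
  let Φ₂ := hardyMul hA (cplx Y) (cplx X)
  have hN : ∀ s : ℂ, 0 ≤ s.re → N.1 s = cplx Z * res (cplx A) s := fun s hs => by
    change cplx Z * hA.resAnalytic.1 s = _
    rw [hA.resAnalytic_apply hs]
  have hcurve : ∀ z : ℂ, inverseCurve Φ₀ Φ₁ Φ₂ N z
      = hardyMul hA (cplx C + z • cplx Y) (cplx B + z • cplx X) (Ring.inverse (1 - z • N)) :=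
    fun z => (hardyMul_add_smul hA _ _ _ _ z _).symm
  have hone : ∀ s : ℂ, (1 : boundedAnalytic r).1 s = 1 := fun s => rfl
  have hev : ∀ᶠ t : ℝ in 𝓝 0, IsUnit (1 - (t : ℂ) • N) ∧
      IsMinimal (A + t • Z) (B + t • X) (C + t • Y) :=
    (eventually_isUnit_one_sub_smul N).and (hmin.eventually Z X Y)
  obtain ⟨ε, hε, hball⟩ := Metric.mem_nhds_iff.1 hev
  rw [Real.ball_eq_Ioo, zero_sub, zero_add] at hball
  refine ⟨Φ₀ N + Φ₁ 1, ⟨fun t : ℝ => inverseCurve Φ₀ Φ₁ Φ₂ N t, ε, hε, ?_, ?_, ?_,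
    hasDerivAt_inverseCurve Φ₀ Φ₁ Φ₂ N⟩, ?_⟩
  · exact fun t ht => (contDiffAt_inverseCurve Φ₀ Φ₁ Φ₂ N (hball ht).1).contDiffWithinAt
  · intro t ht
    obtain ⟨hu, hm⟩ := hball ht
    have hinv : ∀ s : ℂ, 0 ≤ s.re →
        (1 - (t : ℂ) • (cplx Z * res (cplx A) s)) * (Ring.inverse (1 - (t : ℂ) • N)).1 s = 1 := by
      intro s hs
      have h1 := congrArg (fun f : boundedAnalytic r => f.1 s) (Ring.mul_inverse_cancel _ hu)
      rw [← hN s hs]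
      exact h1
    have hpert := fun (s : ℂ) (hs : 0 ≤ s.re) =>
      isUnit_smul_one_sub_add_smul (hA.isUnit hs) (hinv s hs)
    have hcA : cplx (A + t • Z) = cplx A + (t : ℂ) • cplx Z := by rw [cplx_add, cplx_real_smul]
    refine ⟨A + t • Z, B + t • X, C + t • Y, ?_, hm, ?_⟩
    · intro z hz
      by_contra hre
      rw [hcA] at hz
      exact not_mem_spectrum_iff.2 (hpert z (not_lt.1 hre)).1 hz
    · change IsHardyExtension _ _
      simp only [hcurve]
      refine (isHardyExtension_hardyMul hA _ _ _).congr_left fun s hs => ?_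
      rw [transfer_one, hcA, (hpert s hs.le).2, cplx_add, cplx_real_smul, cplx_add, cplx_real_smul]
  · change inverseCurve Φ₀ Φ₁ Φ₂ N ((0 : ℝ) : ℂ) = G
    rw [hcurve, inverse_one_sub_zero_smul]
    refine HasBoundary.unique (hardyMul_boundary hA _ _ _) (hG.ae_eq hA) fun ω => ?_
    rw [hone]
    simp
  · refine HasBoundary.congr ((hardyMul_boundary hA _ _ N).add ((hardyMul_boundary hA _ _ 1).add
      (hardyMul_boundary hA _ _ 1))) fun ω => ?_
    rw [hone, hN _ (by simp), Matrix.mul_one, ← toVal_add, ← toVal_add]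
    simp only [Matrix.mul_assoc, add_assoc]

end Tangent

/-! ### The gradient of the squared distance -/

section Gradient

variable {X : Type*} [NormedAddCommGroup X] [InnerProductSpace ℂ X]

/-- Expanding the squared distance along each line x + tk fixes the real inner product of u with k;
testing with k = u - (x - H) finishes. -/
theorem IsWirtingerGradient.eq_sub {H x u : X}
    (h : IsWirtingerGradient (fun G => ‖H - G‖ ^ 2) x u) : u = x - H := by
  obtain ⟨L, hL, hLu⟩ := h
  have key : ∀ k : X, (inner ℂ (u - (x - H)) k).re = 0 := by
    intro k
    have h1 : HasDerivAt (fun t : ℝ => x + t • k) k 0 := by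
      simpa using ((hasDerivAt_id (0 : ℝ)).smul_const k).const_add x
    have hL' : HasFDerivAt (fun G => ‖H - G‖ ^ 2) L (x + (0 : ℝ) • k) := by simpa using hL
    have h2 := hL'.comp_hasDerivAt (0 : ℝ) h1
    have h3 : ∀ t : ℝ, ‖H - (x + t • k)‖ ^ 2
        = ‖H - x‖ ^ 2 - 2 * t * (inner ℂ (H - x) k).re + t ^ 2 * ‖k‖ ^ 2 := by
      intro t
      have : H - (x + t • k) = (H - x) - ((t : ℂ) • k) := by
        rw [← sub_sub, Complex.coe_smul]
      rw [this, norm_sub_sq (𝕜 := ℂ), inner_smul_right, norm_smul, mul_pow, Complex.norm_real,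
        Real.norm_eq_abs, sq_abs]
      simp only [RCLike.re_to_complex, Complex.re_ofReal_mul]
      ring
    have h4 : HasDerivAt (fun t : ℝ =>
        ‖H - x‖ ^ 2 - 2 * t * (inner ℂ (H - x) k).re + t ^ 2 * ‖k‖ ^ 2)
        (-2 * (inner ℂ (H - x) k).re) 0 := by
      have a1 := (((hasDerivAt_id (0 : ℝ)).const_mul 2).mul_const (inner ℂ (H - x) k).re).const_sub
        (‖H - x‖ ^ 2)
      have a2 := ((hasDerivAt_id (0 : ℝ)).pow 2).mul_const (‖k‖ ^ 2)
      exact (a1.add a2).congr_deriv (by simp)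
    have h5 : HasDerivAt (fun t : ℝ => ‖H - (x + t • k)‖ ^ 2) (L k) 0 := h2
    simp only [h3] at h5
    have h6 := h5.unique h4
    rw [hLu] at h6
    have h7 : u - (x - H) = u + (H - x) := by abel
    rw [h7, inner_add_left, Complex.add_re]
    linarith
  have h0 := key (u - (x - H))
  have h1 := inner_self_eq_norm_sq (𝕜 := ℂ) (u - (x - H))
  rw [RCLike.re_to_complex, h0] at h1
  have h2 : ‖u - (x - H)‖ = 0 := by simpa using h1.symm
  exact sub_eq_zero.1 (norm_eq_zero.1 h2)

theorem inner_sub_smul_sub_smul (v x y z : X) (a b : ℂ) :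
    inner ℂ v (x - a • y - b • z) = inner ℂ v x - a * inner ℂ v y - b * inner ℂ v z := by
  rw [inner_sub_right, inner_sub_right, inner_smul_right, inner_smul_right]

/-- The vector is the sum of the retraction's normal correction and α times the normal part of the
ambient gradient. -/
theorem normalSet_step {M : Set X} {x g y H : X} {α : ℝ}
    (hy : y - (x + -((α : ℂ) • g)) ∈ normalSet M x) (hg : (x - H) - g ∈ normalSet M x) :
    y - ((1 - α : ℝ) : ℂ) • x - (α : ℂ) • H ∈ normalSet M x := by
  intro v hv
  have h1 := hy v hv
  have h2 := hg v hv
  have : y - ((1 - α : ℝ) : ℂ) • x - (α : ℂ) • H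
      = (y - (x + -((α : ℂ) • g))) + (α : ℂ) • ((x - H) - g) := by
    push_cast
    module
  rw [this, inner_add_right, inner_smul_right, Complex.add_re, Complex.re_ofReal_mul, h1, h2]
  simp

end Gradient

/-! ### Interpolation conditions -/

section Interpolation

open scoped Matrix

variable {r n m p : ℕ}

theorem inner_tangent {A : Matrix (Fin r) (Fin r) ℂ} {B : Matrix (Fin r) (Fin m) ℂ}
    {C : Matrix (Fin p) (Fin r) ℂ} {A' : Matrix (Fin n) (Fin n) ℂ} {B' : Matrix (Fin n) (Fin m) ℂ}
    {C' : Matrix (Fin p) (Fin n) ℂ} (hA : Hurwitz A) (hA' : Hurwitz A')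
    {P : Matrix (Fin n) (Fin r) ℂ} {S : Matrix (Fin r) (Fin n) ℂ}
    (hP : A' * P + P * Aᴴ + B' * Bᴴ = 0) (hS : S * A' + Aᴴ * S + Cᴴ * C' = 0)
    {Z : Matrix (Fin r) (Fin r) ℂ} {X : Matrix (Fin r) (Fin m) ℂ} {Y : Matrix (Fin p) (Fin r) ℂ}
    {v F : HardySpace p m}
    (hv : HasBoundary v fun ω =>
      toVal (C * res A (ω * Complex.I) * Z * res A (ω * Complex.I) * B
        + Y * res A (ω * Complex.I) * B + C * res A (ω * Complex.I) * X))
    (hF : HasBoundary F fun ω => toVal (C' * res A' (ω * Complex.I) * B')) :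
    inner ℂ v F
      = (Zᴴ * (S * P)).trace + (Yᴴ * (C' * P)).trace + (Xᴴ * (S * B')).trace := by
  rw [inner_eq_integral_trace hv hF, integral_trace_tangent hA hA' hP hS Z X Y, ← mul_assoc,
    ← Complex.ofReal_mul, inv_mul_cancel₀ (by positivity), Complex.ofReal_one, one_mul]

open scoped ComplexOrder in
theorem eq_zero_of_re_trace {Z : Matrix (Fin r) (Fin r) ℂ} {X : Matrix (Fin r) (Fin m) ℂ}
    {Y : Matrix (Fin p) (Fin r) ℂ}
    (h : ((Zᴴ * Z).trace + (Yᴴ * Y).trace + (Xᴴ * X).trace).re = 0) : Z = 0 ∧ Y = 0 ∧ X = 0 := by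
  have h1 := (Matrix.posSemidef_conjTranspose_mul_self Z).trace_nonneg
  have h2 := (Matrix.posSemidef_conjTranspose_mul_self Y).trace_nonneg
  have h3 := (Matrix.posSemidef_conjTranspose_mul_self X).trace_nonneg
  rw [Complex.nonneg_iff] at h1 h2 h3
  simp only [Complex.add_re] at h
  refine ⟨Matrix.trace_conjTranspose_mul_self_eq_zero_iff.1 (Complex.ext ?_ h1.2.symm),
    Matrix.trace_conjTranspose_mul_self_eq_zero_iff.1 (Complex.ext ?_ h2.2.symm),
    Matrix.trace_conjTranspose_mul_self_eq_zero_iff.1 (Complex.ext ?_ h3.2.symm)⟩ <;>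
  simp only [Complex.zero_re] <;> linarith [h1.1, h2.1, h3.1]

/-- A system whose difference to `(1 - α) Hₖ + α H` is normal at `Hₖ` satisfies the same
interpolation conditions as `(1 - α) Hₖ + α H`. -/
theorem interpolation_of_mem_normalSet {𝕜 : Type*} [RCLike 𝕜] {A : Matrix (Fin n) (Fin n) ℝ}
    {B : Matrix (Fin n) (Fin m) ℝ} {C : Matrix (Fin p) (Fin n) ℝ}
    {Aₖ : Matrix (Fin r) (Fin r) ℝ} {Bₖ : Matrix (Fin r) (Fin m) ℝ} {Cₖ : Matrix (Fin p) (Fin r) ℝ}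
    (hA : Hurwitz (cplx A)) (hAₖ : Hurwitz (cplx Aₖ))
    (hmin : IsMinimal (ofRealMat 𝕜 Aₖ) (ofRealMat 𝕜 Bₖ) (ofRealMat 𝕜 Cₖ))
    {H Hₖ y : HardySpace p m} (hH : HasTransfer H 1 A B C) (hHₖ : HasTransfer Hₖ 1 Aₖ Bₖ Cₖ)
    {Pt Qt : Matrix (Fin n) (Fin r) ℝ} {Ph Qh : Matrix (Fin r) (Fin r) ℝ}
    (hPt : A * Pt + Pt * Aₖᵀ + B * Bₖᵀ = 0) (hPh : Aₖ * Ph + Ph * Aₖᵀ + Bₖ * Bₖᵀ = 0)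
    (hQt : Aᵀ * Qt + Qt * Aₖ + Cᵀ * Cₖ = 0) (hQh : Aₖᵀ * Qh + Qh * Aₖ + Cₖᵀ * Cₖ = 0)
    {α : ℝ} (hw : y - ((1 - α : ℝ) : ℂ) • Hₖ - (α : ℂ) • H ∈ normalSet (stableManifold 𝕜 r m p) Hₖ)
    {A' : Matrix (Fin r) (Fin r) 𝕜} {B' : Matrix (Fin r) (Fin m) 𝕜} {C' : Matrix (Fin p) (Fin r) 𝕜}
    (hA' : Hurwitz (cplx A')) (hy : HasTransfer y 1 A' B' C') :
    ∃ P S : Matrix (Fin r) (Fin r) ℂ,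
      S * cplx A' + cplx Aₖᵀ * S + cplx Cₖᵀ * cplx C' = 0 ∧
      S * P = cplx ((1 - α) • (Qhᵀ * Ph) + α • (Qtᵀ * Pt)) ∧
      cplx C' * P = cplx ((1 - α) • (Cₖ * Ph) + α • (C * Pt)) ∧
      S * cplx B' = cplx ((1 - α) • (Qhᵀ * Bₖ) + α • (Qtᵀ * B)) := by
  set a := ofRealMat 𝕜 Aₖ with ha
  set b := ofRealMat 𝕜 Bₖ with hb
  set c := ofRealMat 𝕜 Cₖ with hc
  have hca : cplx a = cplx Aₖ := cplx_ofRealMat _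
  have hcb : cplx b = cplx Bₖ := cplx_ofRealMat _
  have hcc : cplx c = cplx Cₖ := cplx_ofRealMat _
  have haT : Hurwitz (cplx aᴴ) := by
    rw [cplx_conjTranspose, hca]
    exact hAₖ.conjTranspose
  -- Solving over 𝕜 rather than ℂ keeps the directions Z, Y, X below over 𝕜, as the tangent curves
  -- require.
  obtain ⟨P, hP, -⟩ := existsUnique_sylvester hA' haT (B' * bᴴ)
  obtain ⟨S, hS, -⟩ := existsUnique_sylvester haT hA' (cᴴ * C')
  replace hP := congrArg cplx hP
  replace hS := congrArg cplx hS
  simp only [cplx_add, cplx_mul, cplx_zero, cplx_conjTranspose, hca, hcb, hcc] at hP hS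
  rw [add_comm (_ * cplx S)] at hS
  have hTk : HasTransfer Hₖ 1 a b c := by
    have : transfer 1 a b c = transfer 1 Aₖ Bₖ Cₖ := by
      funext s
      rw [transfer_one, transfer_one, hca, hcb, hcc]
    rw [HasTransfer, this]
    exact hHₖ
  -- The test direction is the mismatch in the interpolation conditions, so its pairing with the
  -- normal vector is the sum of squared norms of Z, Y and X.
  let Z := S * P - ofRealMat 𝕜 ((1 - α) • (Qhᵀ * Ph) + α • (Qtᵀ * Pt))
  let Y := C' * P - ofRealMat 𝕜 ((1 - α) • (Cₖ * Ph) + α • (C * Pt))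
  let X := S * B' - ofRealMat 𝕜 ((1 - α) • (Qhᵀ * Bₖ) + α • (Qtᵀ * B))
  have hZ : cplx Z = cplx S * cplx P - (((1 - α : ℝ) : ℂ) • (cplx Qhᵀ * cplx Ph)
      + (α : ℂ) • (cplx Qtᵀ * cplx Pt)) := by
    simp only [Z, cplx_sub, cplx_mul, cplx_ofRealMat, cplx_add, cplx_real_smul]
  have hY : cplx Y = cplx C' * cplx P - (((1 - α : ℝ) : ℂ) • (cplx Cₖ * cplx Ph)
      + (α : ℂ) • (cplx C * cplx Pt)) := by
    simp only [Y, cplx_sub, cplx_mul, cplx_ofRealMat, cplx_add, cplx_real_smul]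
  have hX : cplx X = cplx S * cplx B' - (((1 - α : ℝ) : ℂ) • (cplx Qhᵀ * cplx Bₖ)
      + (α : ℂ) • (cplx Qtᵀ * cplx B)) := by
    simp only [X, cplx_sub, cplx_mul, cplx_ofRealMat, cplx_add, cplx_real_smul]
  obtain ⟨v, hvT, hv⟩ := exists_mem_tangentSet (by rwa [hca]) hmin hTk Z X Y
  rw [hca, hcb, hcc] at hv
  have lyap : ∀ {q : ℕ} {D : Matrix (Fin q) (Fin q) ℝ} {N : Matrix (Fin p) (Fin q) ℝ}
      {Q : Matrix (Fin q) (Fin r) ℝ}, Dᵀ * Q + Q * Aₖ + Nᵀ * Cₖ = 0 →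
      cplx Qᵀ * cplx D + (cplx Aₖ)ᴴ * cplx Qᵀ + (cplx Cₖ)ᴴ * cplx N = 0 := by
    intro q D N Q h
    have := congrArg (fun M => cplx Mᵀ) h
    simpa only [Matrix.transpose_add, Matrix.transpose_mul, Matrix.transpose_transpose,
      Matrix.transpose_zero, cplx_add, cplx_mul, cplx_zero, cplx_conjTranspose_real] using this
  have ctrl : ∀ {q : ℕ} {D : Matrix (Fin q) (Fin q) ℝ} {N : Matrix (Fin q) (Fin m) ℝ}
      {R : Matrix (Fin q) (Fin r) ℝ}, D * R + R * Aₖᵀ + N * Bₖᵀ = 0 →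
      cplx D * cplx R + cplx R * (cplx Aₖ)ᴴ + cplx N * (cplx Bₖ)ᴴ = 0 := by
    intro q D N R h
    have := congrArg cplx h
    simpa only [cplx_add, cplx_mul, cplx_zero, cplx_conjTranspose_real] using this
  have e1 := inner_tangent hAₖ hA' hP hS hv (hy.ae_eq hA')
  have e2 := inner_tangent hAₖ hAₖ (ctrl hPh) (lyap hQh) hv (hHₖ.ae_eq hAₖ)
  have e3 := inner_tangent hAₖ hA (ctrl hPt) (lyap hQt) hv (hH.ae_eq hA)
  have hre := (congrArg Complex.re
    (inner_sub_smul_sub_smul v y Hₖ H ((1 - α : ℝ) : ℂ) (α : ℂ))).symm.trans (hw v hvT)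
  rw [e1, e2, e3] at hre
  have hsum : (((cplx Z)ᴴ * cplx Z).trace + ((cplx Y)ᴴ * cplx Y).trace
      + ((cplx X)ᴴ * cplx X).trace).re = 0 := by
    rw [← hre]
    congr 1
    nth_rewrite 2 [hZ]
    nth_rewrite 2 [hY]
    nth_rewrite 2 [hX]
    simp only [Matrix.mul_sub, Matrix.mul_add, Matrix.mul_smul, Matrix.trace_sub, Matrix.trace_add,
      Matrix.trace_smul, smul_eq_mul]
    ring
  obtain ⟨z1, z2, z3⟩ := eq_zero_of_re_trace hsum
  refine ⟨cplx P, cplx S, ?_, ?_, ?_, ?_⟩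
  · simpa only [cplx_conjTranspose_real] using hS
  · rw [hZ, sub_eq_zero] at z1
    simpa only [cplx_add, cplx_mul, cplx_real_smul] using z1
  · rw [hY, sub_eq_zero] at z2
    simpa only [cplx_add, cplx_mul, cplx_real_smul] using z2
  · rw [hX, sub_eq_zero] at z3
    simpa only [cplx_add, cplx_mul, cplx_real_smul] using z3

end Interpolation

section Descriptor

open scoped Matrix

variable {n r m p : ℕ}

/-! ### Generalized Sylvester equations -/

theorem isUnit_transpose {E : Matrix (Fin n) (Fin n) ℝ} (hE : IsUnit E) : IsUnit Eᵀ := by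
  rwa [Matrix.isUnit_transpose]

/-- The generalized equation is the standard one multiplied by E on the left and Fᵀ on the right;
the unknown P is unchanged. -/
theorem controllability_eq_iff {E A : Matrix (Fin n) (Fin n) ℝ} {F D : Matrix (Fin r) (Fin r) ℝ}
    (hE : IsUnit E) (hF : IsUnit F) (B : Matrix (Fin n) (Fin m) ℝ) (N : Matrix (Fin r) (Fin m) ℝ)
    (P : Matrix (Fin n) (Fin r) ℝ) :
    A * P * Fᵀ + E * P * Dᵀ + B * Nᵀ = 0 ↔
      (E⁻¹ * A) * P + P * (F⁻¹ * D)ᵀ + (E⁻¹ * B) * (F⁻¹ * N)ᵀ = 0 := by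
  rw [Matrix.isUnit_iff_isUnit_det] at hE hF
  have hF' : IsUnit Fᵀ.det := by rwa [Matrix.det_transpose]
  have h1 : A * P * Fᵀ + E * P * Dᵀ + B * Nᵀ
      = E * ((E⁻¹ * A) * P + P * (F⁻¹ * D)ᵀ + (E⁻¹ * B) * (F⁻¹ * N)ᵀ) * Fᵀ := by
    simp only [Matrix.mul_add, Matrix.add_mul, Matrix.transpose_mul, Matrix.transpose_nonsing_inv,
      Matrix.mul_assoc, Matrix.nonsing_inv_mul _ hF', Matrix.mul_one,
      Matrix.mul_nonsing_inv_cancel_left _ _ hE]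
  rw [h1]
  constructor
  · intro h
    have := congrArg (fun M => E⁻¹ * M * (Fᵀ)⁻¹) h
    simpa only [Matrix.mul_zero, Matrix.zero_mul, Matrix.mul_assoc,
      Matrix.nonsing_inv_mul_cancel_left _ _ hE, Matrix.mul_nonsing_inv _ hF', Matrix.mul_one]
      using this
  · intro h
    rw [h, Matrix.mul_zero, Matrix.zero_mul]

/-- Here, by contrast, the unknown changes: EᵀQF is what solves the standard equation. -/
theorem observability_eq {E A : Matrix (Fin n) (Fin n) ℝ} {F D : Matrix (Fin r) (Fin r) ℝ}
    (hE : IsUnit E) (hF : IsUnit F) (M : Matrix (Fin n) (Fin r) ℝ) (Q : Matrix (Fin n) (Fin r) ℝ) :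
    Aᵀ * Q * F + Eᵀ * Q * D + M
      = (E⁻¹ * A)ᵀ * (Eᵀ * Q * F) + (Eᵀ * Q * F) * (F⁻¹ * D) + M := by
  rw [Matrix.isUnit_iff_isUnit_det] at hE hF
  have hE' : IsUnit Eᵀ.det := by rwa [Matrix.det_transpose]
  simp only [Matrix.transpose_mul, Matrix.transpose_nonsing_inv, Matrix.mul_assoc,
    Matrix.nonsing_inv_mul_cancel_left _ _ hE', Matrix.mul_nonsing_inv_cancel_left _ _ hF]

theorem Hurwitz.cplx_transpose {A : Matrix (Fin n) (Fin n) ℝ} (hA : Hurwitz (cplx A)) :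
    Hurwitz (cplx Aᵀ) := by
  rw [← cplx_conjTranspose_real]
  exact hA.conjTranspose

theorem existsUnique_controllability {E A : Matrix (Fin n) (Fin n) ℝ}
    {F D : Matrix (Fin r) (Fin r) ℝ} (hEA : StablePencil E A) (hFD : StablePencil F D)
    (B : Matrix (Fin n) (Fin m) ℝ) (N : Matrix (Fin r) (Fin m) ℝ) :
    ∃! P : Matrix (Fin n) (Fin r) ℝ, A * P * Fᵀ + E * P * Dᵀ + B * Nᵀ = 0 := by
  simp only [controllability_eq_iff hEA.1 hFD.1]
  exact existsUnique_sylvester hEA.2 hFD.2.cplx_transpose _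

theorem existsUnique_observability {E A : Matrix (Fin n) (Fin n) ℝ}
    {F D : Matrix (Fin r) (Fin r) ℝ} (hEA : StablePencil E A) (hFD : StablePencil F D)
    (M : Matrix (Fin n) (Fin r) ℝ) :
    ∃! Q : Matrix (Fin n) (Fin r) ℝ, Aᵀ * Q * F + Eᵀ * Q * D + M = 0 := by
  simp only [observability_eq hEA.1 hFD.1]
  obtain ⟨Q, hQ, huniq⟩ := existsUnique_sylvester hEA.2.cplx_transpose hFD.2 M
  have hE := (Matrix.isUnit_iff_isUnit_det _).1 (isUnit_transpose hEA.1)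
  have hF := (Matrix.isUnit_iff_isUnit_det _).1 hFD.1
  refine ⟨(Eᵀ)⁻¹ * Q * F⁻¹, ?_, fun R hR => ?_⟩
  · have : Eᵀ * ((Eᵀ)⁻¹ * Q * F⁻¹) * F = Q := by
      simp only [Matrix.mul_assoc, Matrix.mul_nonsing_inv_cancel_left _ _ hE,
        Matrix.nonsing_inv_mul _ hF, Matrix.mul_one]
    simpa only [this] using hQ
  · rw [← huniq _ hR]
    simp only [Matrix.mul_assoc, Matrix.nonsing_inv_mul_cancel_left _ _ hE,
      Matrix.mul_nonsing_inv _ hF, Matrix.mul_one]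

/-! ### Realizations of the current iterate -/

/-- Membership supplies some minimal realization over 𝕜. The given real one has the same order and
the same boundary function, hence the same Markov parameters, and `IsMinimal.of_markov` transfers
minimality. -/
theorem isMinimal_of_mem_stableManifold {𝕜 : Type*} [RCLike 𝕜] {A : Matrix (Fin r) (Fin r) ℝ}
    {B : Matrix (Fin r) (Fin m) ℝ} {C : Matrix (Fin p) (Fin r) ℝ} (hA : Hurwitz (cplx A))
    {G : HardySpace p m} (hG : HasTransfer G 1 A B C) (hmem : G ∈ stableManifold 𝕜 r m p) :
    IsMinimal (ofRealMat 𝕜 A) (ofRealMat 𝕜 B) (ofRealMat 𝕜 C) := by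
  obtain ⟨A₀, B₀, C₀, hA₀, hmin, hG₀⟩ := hmem
  have hcont : ∀ {q : ℕ} {A : Matrix (Fin q) (Fin q) ℂ} (B : Matrix (Fin q) (Fin m) ℂ)
      (C : Matrix (Fin p) (Fin q) ℂ), Hurwitz A →
      Continuous fun ω : ℝ => C * res A (ω * Complex.I) * B := by
    intro q A B C hA
    have h1 : Continuous fun ω : ℝ => res A (ω * Complex.I) :=
      continuous_iff_continuousAt.2 fun ω =>
        ContinuousAt.comp (f := fun ω : ℝ => (ω * Complex.I : ℂ))
          (hA.continuousAt_res (by simp)) (by fun_prop)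
    fun_prop
  have hinj : Function.Injective (toVal : Matrix (Fin p) (Fin m) ℂ → Val p m) := by
    intro M N h
    ext i j
    exact congrFun (congrArg WithLp.ofLp h) (i, j)
  have hall : ∀ ω : ℝ, cplx C₀ * res (cplx A₀) (ω * Complex.I) * cplx B₀
      = cplx C * res (cplx A) (ω * Complex.I) * cplx B := by
    refine congrFun (Continuous.ae_eq_iff_eq volume (hcont _ _ hA₀) (hcont _ _ hA) |>.1 ?_)
    filter_upwards [hG₀.ae_eq hA₀, hG.ae_eq hA] with ω h1 h2
    exact hinj (h1.symm.trans h2)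
  refine hmin.of_markov ?_
  -- Agreement is known only on the imaginary axis, so infinity is approached along it.
  refine markov_eq_of_transfer (l := map (fun ω : ℝ => (ω * Complex.I : ℂ)) atTop) ?_ ?_
  · change Tendsto _ _ _
    rw [← tendsto_norm_atTop_iff_cobounded]
    simpa using tendsto_abs_atTop_atTop
  · rw [eventually_map]
    refine Eventually.of_forall fun ω => ?_
    simp only [transfer_one, cplx_ofRealMat]
    exact hall ω

/-! ### Regularity and equivalence of pencils -/

theorem relax_eq (α : ℝ) (X Y : Matrix (Fin n) (Fin m) ℝ) :
    relax α X Y = (1 - α) • X + α • Y := by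
  rw [relax]
  module

/-- Fix s = 1. The determinant there is a polynomial in α of degree at most r, and at α = 0 it is
det(E - A), nonzero because 1 lies in the right half-plane. Irregularity forces α to be a root. -/
theorem encard_not_regularPencil_le {E A : Matrix (Fin r) (Fin r) ℝ} (hEA : StablePencil E A)
    (M N : Matrix (Fin r) (Fin r) ℝ) :
    {α : ℝ | ¬ RegularPencil (relax α E M) (relax α A N)}.encard ≤ r := by
  let D₀ : Matrix (Fin r) (Fin r) ℂ := (1 : ℂ) • cplx E - cplx A
  let D₁ : Matrix (Fin r) (Fin r) ℂ := ((1 : ℂ) • cplx M - cplx N) - D₀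
  have hD₀ : D₀.det ≠ 0 := by
    have hE : IsUnit (cplx E).det := (Matrix.isUnit_iff_isUnit_det _).1 (isUnit_cplx_iff.2 hEA.1)
    have h1 := hEA.2.isUnit (s := 1) (by simp)
    rw [Matrix.isUnit_iff_isUnit_det] at h1
    have h2 : D₀ = cplx E * ((1 : ℂ) • 1 - cplx (E⁻¹ * A)) := by
      rw [Matrix.mul_sub, cplx_mul, cplx_inv, Matrix.mul_nonsing_inv_cancel_left _ _ hE,
        Matrix.mul_smul, Matrix.mul_one]
    rw [h2, Matrix.det_mul]
    exact (hE.mul h1).ne_zero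
  let q : Polynomial ℂ :=
    (((Polynomial.X : Polynomial ℂ) • D₁.map Polynomial.C + D₀.map Polynomial.C)).det
  have hq : ∀ z : ℂ, q.eval z = (z • D₁ + D₀).det := by
    intro z
    simp only [q]
    rw [← Polynomial.coe_evalRingHom, RingHom.map_det]
    congr 1
    ext i j
    simp
    exact mul_comm _ _
  have hq0 : q ≠ 0 := fun h0 => hD₀ (by simpa [h0] using (hq 0).symm)
  have hdeg : q.natDegree ≤ r := by
    simpa using Polynomial.natDegree_det_X_add_C_le D₁ D₀
  have hsub : (fun α : ℝ => (α : ℂ)) '' {α : ℝ | ¬ RegularPencil (relax α E M) (relax α A N)}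
      ⊆ (q.roots.toFinset : Set ℂ) := by
    rintro _ ⟨α, hα, rfl⟩
    rw [Finset.mem_coe, Multiset.mem_toFinset, Polynomial.mem_roots hq0, Polynomial.IsRoot, hq]
    by_contra hne
    refine hα ⟨1, ?_⟩
    convert hne using 2
    simp only [relax_eq, cplx_add, cplx_real_smul, D₁, D₀]
    push_cast
    module
  rw [← Complex.ofReal_injective.injOn.encard_image]
  calc _ ≤ (q.roots.toFinset : Set ℂ).encard := Set.encard_le_encard hsub
    _ = (q.roots.toFinset.card : ℕ∞) := Set.encard_coe_eq_coe_finsetCard _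
    _ ≤ r := by
      exact_mod_cast (Multiset.toFinset_card_le _).trans ((Polynomial.card_roots' q).trans hdeg)

/-- A regular pencil realization that factors through `S` and `P` is equivalent to
`(A', B', C')`. -/
theorem realization_of_factorization {K R S P E A A' : Matrix (Fin r) (Fin r) ℂ}
    {B B' : Matrix (Fin r) (Fin m) ℂ} {C C' : Matrix (Fin p) (Fin r) ℂ} (hK : IsUnit K)
    (hR : IsUnit R) (hE : K * E * R = S * P) (hA : K * A * R = S * A' * P)
    (hB : K * B = S * B') (hC : C * R = C' * P) (hreg : ∃ s : ℂ, (s • E - A).det ≠ 0) :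
    IsUnit E ∧ (∀ s : ℂ, IsUnit (s • (1 : Matrix (Fin r) (Fin r) ℂ) - A') → IsUnit (s • E - A)) ∧
      ∀ s : ℂ, C * (s • E - A)⁻¹ * B = C' * res A' s * B' := by
  rw [Matrix.isUnit_iff_isUnit_det] at hK hR
  have hpen : ∀ s : ℂ, K * (s • E - A) * R = S * (s • 1 - A') * P := by
    intro s
    simp only [Matrix.mul_sub, Matrix.sub_mul, Matrix.mul_smul, Matrix.smul_mul, hE, hA,
      Matrix.mul_one]
  have hdet : ∀ s : ℂ, K.det * (s • E - A).det * R.det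
      = S.det * (s • (1 : Matrix (Fin r) (Fin r) ℂ) - A').det * P.det := by
    intro s
    simpa only [Matrix.det_mul] using congrArg Matrix.det (hpen s)
  obtain ⟨s₀, hs₀⟩ := hreg
  -- One point of regularity is enough to make S and P invertible, as their determinants do not
  -- depend on s.
  have hne : S.det * (s₀ • (1 : Matrix (Fin r) (Fin r) ℂ) - A').det * P.det ≠ 0 := by
    rw [← hdet]
    exact mul_ne_zero (mul_ne_zero hK.ne_zero hs₀) hR.ne_zero
  have hS : IsUnit S.det := isUnit_iff_ne_zero.2 (left_ne_zero_of_mul (left_ne_zero_of_mul hne))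
  have hP : IsUnit P.det := isUnit_iff_ne_zero.2 (right_ne_zero_of_mul hne)
  refine ⟨?_, fun s hs => ?_, fun s => ?_⟩
  · rw [Matrix.isUnit_iff_isUnit_det, isUnit_iff_ne_zero]
    intro h0
    have h1 := congrArg Matrix.det hE
    rw [Matrix.det_mul, Matrix.det_mul, h0, Matrix.det_mul, mul_zero, zero_mul] at h1
    exact (hS.mul hP).ne_zero h1.symm
  · rw [Matrix.isUnit_iff_isUnit_det] at hs ⊢
    rw [isUnit_iff_ne_zero]
    intro h0
    have h1 := hdet s
    rw [h0, mul_zero, zero_mul] at h1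
    exact ((hS.mul hs).mul hP).ne_zero h1.symm
  · have h1 : s • E - A = K⁻¹ * (S * (s • 1 - A') * P) * R⁻¹ := by
      rw [← hpen]
      simp only [Matrix.mul_assoc, Matrix.nonsing_inv_mul_cancel_left _ _ hK,
        Matrix.mul_nonsing_inv _ hR, Matrix.mul_one]
    have h2 : B = K⁻¹ * (S * B') := by rw [← hB, Matrix.nonsing_inv_mul_cancel_left _ _ hK]
    have h3 : C = C' * P * R⁻¹ := by rw [← hC, Matrix.mul_nonsing_inv_cancel_right _ _ hR]
    rw [h1, h2, h3, Matrix.mul_inv_rev, Matrix.mul_inv_rev, Matrix.mul_inv_rev, Matrix.mul_inv_rev,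
      Matrix.nonsing_inv_nonsing_inv _ hK, Matrix.nonsing_inv_nonsing_inv _ hR, res]
    simp only [Matrix.mul_assoc, Matrix.nonsing_inv_mul_cancel_left _ _ hR,
      Matrix.mul_nonsing_inv_cancel_left _ _ hK, Matrix.mul_nonsing_inv_cancel_left _ _ hP,
      Matrix.nonsing_inv_mul_cancel_left _ _ hS]

end Descriptor

/-! ### The update formulas compressed by the Gramians. -/

section Update

open scoped Matrix

variable {n r m p : ℕ}

/-- The updated descriptor matrices, compressed by the Gramians, are the projections of
`(1 - α) Hₖ + α H` that appear in the interpolation conditions. -/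
theorem compress_relax {E A : Matrix (Fin n) (Fin n) ℝ} {B : Matrix (Fin n) (Fin m) ℝ}
    {C : Matrix (Fin p) (Fin n) ℝ} {Eₖ Aₖ : Matrix (Fin r) (Fin r) ℝ}
    {Bₖ : Matrix (Fin r) (Fin m) ℝ} {Cₖ : Matrix (Fin p) (Fin r) ℝ}
    (hE : IsUnit E) (hEₖ : IsUnit Eₖ) (Pt Qt : Matrix (Fin n) (Fin r) ℝ)
    {Ph Qh : Matrix (Fin r) (Fin r) ℝ} (hPh : IsUnit Ph) (hQh : IsUnit Qh) (α : ℝ) :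
    Eₖᵀ * Qh * relax α Eₖ (Qh⁻¹ * Qtᵀ * E * Pt * Ph⁻¹) * Ph
        = (1 - α) • ((Eₖᵀ * Qh * Eₖ) * Ph) + α • ((Eᵀ * Qt * Eₖ)ᵀ * Pt) ∧
    Eₖᵀ * Qh * relax α Aₖ (Qh⁻¹ * Qtᵀ * A * Pt * Ph⁻¹) * Ph
        = (1 - α) • ((Eₖᵀ * Qh * Eₖ) * (Eₖ⁻¹ * Aₖ) * Ph)
          + α • ((Eᵀ * Qt * Eₖ)ᵀ * (E⁻¹ * A) * Pt) ∧
    Eₖᵀ * Qh * relax α Bₖ (Qh⁻¹ * Qtᵀ * B)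
        = (1 - α) • ((Eₖᵀ * Qh * Eₖ) * (Eₖ⁻¹ * Bₖ)) + α • ((Eᵀ * Qt * Eₖ)ᵀ * (E⁻¹ * B)) ∧
    relax α Cₖ (C * Pt * Ph⁻¹) * Ph = (1 - α) • (Cₖ * Ph) + α • (C * Pt) := by
  rw [Matrix.isUnit_iff_isUnit_det] at hE hEₖ hPh hQh
  simp only [relax_eq, Matrix.mul_add, Matrix.add_mul, Matrix.mul_smul, Matrix.smul_mul,
    Matrix.transpose_mul, Matrix.transpose_transpose, Matrix.mul_assoc,
    Matrix.nonsing_inv_mul _ hPh, Matrix.mul_one, Matrix.mul_nonsing_inv_cancel_left _ _ hQh,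
    Matrix.mul_nonsing_inv_cancel_left _ _ hE, Matrix.mul_nonsing_inv_cancel_left _ _ hEₖ,
    and_self]

/-- The transpose solves the same equation. This reconciles the transposed Gramian in the
interpolation conditions with the untransposed one in the update. -/
theorem transpose_eq_of_lyapunov {A Q M : Matrix (Fin r) (Fin r) ℝ} (hA : Hurwitz (cplx A))
    (hM : Mᵀ = M) (hQ : Aᵀ * Q + Q * A + M = 0) : Qᵀ = Q := by
  refine (existsUnique_sylvester hA.cplx_transpose hA M).unique ?_ hQ
  have := congrArg Matrix.transpose hQ
  simp only [Matrix.transpose_add, Matrix.transpose_mul, Matrix.transpose_transpose,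
    Matrix.transpose_zero, hM] at this
  rw [← this]
  abel

end Update

end H2Red

/-! ### The main theorem. -/

open scoped Matrix

theorem mainTheorem5 (𝕜 : Type) [RCLike 𝕜] {n r m p : ℕ}
    (E A : Matrix (Fin n) (Fin n) ℝ) (B : Matrix (Fin n) (Fin m) ℝ)
    (C : Matrix (Fin p) (Fin n) ℝ)
    (Eₖ Aₖ : Matrix (Fin r) (Fin r) ℝ) (Bₖ : Matrix (Fin r) (Fin m) ℝ)
    (Cₖ : Matrix (Fin p) (Fin r) ℝ)
    (hEA : StablePencil E A) (hEAₖ : StablePencil Eₖ Aₖ)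
    (H Hₖ : HardySpace p m)
    (hH : HasTransfer H E A B C) (hHₖ : HasTransfer Hₖ Eₖ Aₖ Bₖ Cₖ)
    (hmem : Hₖ ∈ stableManifold 𝕜 r m p) :
    (∃! P : Matrix (Fin n) (Fin r) ℝ,
      A * P * Eₖ.transpose + E * P * Aₖ.transpose + B * Bₖ.transpose = 0) ∧
    (∃! P : Matrix (Fin r) (Fin r) ℝ,
      Aₖ * P * Eₖ.transpose + Eₖ * P * Aₖ.transpose + Bₖ * Bₖ.transpose = 0) ∧
    (∃! Q : Matrix (Fin n) (Fin r) ℝ,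
      A.transpose * Q * Eₖ + E.transpose * Q * Aₖ + C.transpose * Cₖ = 0) ∧
    (∃! Q : Matrix (Fin r) (Fin r) ℝ,
      Aₖ.transpose * Q * Eₖ + Eₖ.transpose * Q * Aₖ + Cₖ.transpose * Cₖ = 0) ∧
    ∀ (Pt Qt : Matrix (Fin n) (Fin r) ℝ) (Ph Qh : Matrix (Fin r) (Fin r) ℝ),
      A * Pt * Eₖ.transpose + E * Pt * Aₖ.transpose + B * Bₖ.transpose = 0 →
      Aₖ * Ph * Eₖ.transpose + Eₖ * Ph * Aₖ.transpose + Bₖ * Bₖ.transpose = 0 →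
      A.transpose * Qt * Eₖ + E.transpose * Qt * Aₖ + C.transpose * Cₖ = 0 →
      Aₖ.transpose * Qh * Eₖ + Eₖ.transpose * Qh * Aₖ + Cₖ.transpose * Cₖ = 0 →
      IsUnit Ph ∧ IsUnit Qh ∧
      {α : ℝ | ¬ RegularPencil
        (relax α Eₖ (Qh⁻¹ * Qt.transpose * E * Pt * Ph⁻¹))
        (relax α Aₖ (Qh⁻¹ * Qt.transpose * A * Pt * Ph⁻¹))}.encard ≤ r ∧
      ∀ α : ℝ, 0 < α →
        ∀ g : HardySpace p m,
          IsRiemannianGradient (stableManifold 𝕜 r m p) (h2Error H) Hₖ g →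
        ∀ Hₖ₁ : HardySpace p m,
          IsOrthographicRetraction (stableManifold 𝕜 r m p) Hₖ (-((α : ℂ) • g)) Hₖ₁ →
        ∀ (Eₖ₁ Aₖ₁ : Matrix (Fin r) (Fin r) ℝ) (Bₖ₁ : Matrix (Fin r) (Fin m) ℝ)
          (Cₖ₁ : Matrix (Fin p) (Fin r) ℝ),
          Eₖ₁ = relax α Eₖ (Qh⁻¹ * Qt.transpose * E * Pt * Ph⁻¹) →
          Aₖ₁ = relax α Aₖ (Qh⁻¹ * Qt.transpose * A * Pt * Ph⁻¹) →
          Bₖ₁ = relax α Bₖ (Qh⁻¹ * Qt.transpose * B) →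
          Cₖ₁ = relax α Cₖ (C * Pt * Ph⁻¹) →
          RegularPencil Eₖ₁ Aₖ₁ →
          StablePencil Eₖ₁ Aₖ₁ ∧ HasTransfer Hₖ₁ Eₖ₁ Aₖ₁ Bₖ₁ Cₖ₁ := by
  refine ⟨existsUnique_controllability hEA hEAₖ B Bₖ, existsUnique_controllability hEAₖ hEAₖ Bₖ Bₖ,
    existsUnique_observability hEA hEAₖ _, existsUnique_observability hEAₖ hEAₖ _, ?_⟩
  intro Pt Qt Ph Qh hPt hPh hQt hQh
  rw [hasTransfer_iff_one hEA.1] at hH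
  rw [hasTransfer_iff_one hEAₖ.1] at hHₖ
  rw [controllability_eq_iff hEA.1 hEAₖ.1] at hPt
  rw [controllability_eq_iff hEAₖ.1 hEAₖ.1] at hPh
  rw [observability_eq hEA.1 hEAₖ.1] at hQt
  rw [observability_eq hEAₖ.1 hEAₖ.1] at hQh
  have hmin := isMinimal_of_mem_stableManifold hEAₖ.2 hHₖ hmem
  have hsymm := transpose_eq_of_lyapunov hEAₖ.2 (by simp) hQh
  have hPhU : IsUnit Ph := hmin.isUnit_gramian hEAₖ.2 hPh
  have hQhU' : IsUnit (Eₖᵀ * Qh * Eₖ) :=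
    -- The observability Gramian is the controllability Gramian of the dual system.
    IsMinimal.isUnit_gramian (𝕜 := 𝕜) (A := (Eₖ⁻¹ * Aₖ)ᵀ) (B := Cₖᵀ) hmin.transpose
      hEAₖ.2.cplx_transpose (by simpa only [Matrix.transpose_transpose] using hQh)
  have hQhU : IsUnit Qh := by
    rw [Matrix.isUnit_iff_isUnit_det, Matrix.det_mul, Matrix.det_mul] at hQhU'
    rw [Matrix.isUnit_iff_isUnit_det]
    exact isUnit_of_mul_isUnit_right (isUnit_of_mul_isUnit_left hQhU')
  refine ⟨hPhU, hQhU, encard_not_regularPencil_le hEAₖ _ _, ?_⟩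
  rintro α - g ⟨-, u, hu, hug⟩ y ⟨hyM, hyN, -⟩ E₁ A₁ B₁ C₁ hE₁ hA₁ hB₁ hC₁ hreg
  obtain ⟨A', B', C', hA', -, hy⟩ := hyM
  have hu' : u = Hₖ - H := IsWirtingerGradient.eq_sub hu
  rw [hu'] at hug
  obtain ⟨P, S, hS, hSP, hCP, hSB⟩ := interpolation_of_mem_normalSet hEA.2 hEAₖ.2 hmin hH hHₖ
    hPt hPh hQt hQh (normalSet_step hyN hug) hA' hy
  obtain ⟨cE, cA, cB, cC⟩ := compress_relax (A := A) (B := B) (C := C) (Aₖ := Aₖ) (Bₖ := Bₖ)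
    (Cₖ := Cₖ) hEA.1 hEAₖ.1 Pt Qt hPhU hQhU α
  rw [← hE₁] at cE
  rw [← hA₁] at cA
  rw [← hB₁] at cB
  rw [← hC₁] at cC
  rw [hsymm, ← cE] at hSP
  rw [hsymm, ← cB] at hSB
  rw [← cC] at hCP
  have hQhA : (Eₖᵀ * Qh * Eₖ) * (Eₖ⁻¹ * Aₖ) = -((Eₖ⁻¹ * Aₖ)ᵀ * (Eₖᵀ * Qh * Eₖ)) - Cₖᵀ * Cₖ := by
    rw [← sub_eq_zero, ← hQh]
    abel
  have hQtA : (Eᵀ * Qt * Eₖ)ᵀ * (E⁻¹ * A)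
      = -((Eₖ⁻¹ * Aₖ)ᵀ * (Eᵀ * Qt * Eₖ)ᵀ) - Cₖᵀ * C := by
    have := congrArg Matrix.transpose hQt
    rw [Matrix.transpose_add, Matrix.transpose_add, Matrix.transpose_mul, Matrix.transpose_mul _ᵀ,
      Matrix.transpose_mul _ (Eₖ⁻¹ * Aₖ), Matrix.transpose_transpose, Matrix.transpose_transpose,
      Matrix.transpose_zero] at this
    rw [← sub_eq_zero, ← this]
    abel
  -- The interpolation conditions do not mention A'. The equation for S expresses SA'P through SP
  -- and C'P, and the Lyapunov and Sylvester equations for Q̂ and Q̃ express the compressed A₁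
  -- through the compressed E₁ and C₁ in the same way.
  have hSA : S * cplx A' * P = cplx (Eₖᵀ * Qh * A₁ * Ph) := by
    have h1 : Eₖᵀ * Qh * A₁ * Ph = -((Eₖ⁻¹ * Aₖ)ᵀ * (Eₖᵀ * Qh * E₁ * Ph)) - Cₖᵀ * (C₁ * Ph) := by
      rw [cA, cE, cC, hQhA, hQtA]
      simp only [Matrix.sub_mul, Matrix.neg_mul, Matrix.mul_add, Matrix.mul_smul, Matrix.mul_assoc]
      module
    have h2 : S * cplx A' = 0 - cplx (Eₖ⁻¹ * Aₖ)ᵀ * S - cplx Cₖᵀ * cplx C' := by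
      rw [← hS]
      abel
    rw [h1, h2, cplx_sub, ← zero_sub, cplx_sub, cplx_mul _ (_ * Ph), cplx_mul _ (C₁ * Ph), ← hSP,
      ← hCP, cplx_zero]
    simp only [Matrix.sub_mul, Matrix.zero_mul, Matrix.mul_assoc]
  obtain ⟨hU, hstab, htr⟩ := realization_of_factorization (K := cplx (Eₖᵀ * Qh)) (R := cplx Ph)
    (E := cplx E₁) (A := cplx A₁) (B := cplx B₁) (C := cplx C₁)
    (isUnit_cplx_iff.2 ((isUnit_transpose hEAₖ.1).mul hQhU)) (isUnit_cplx_iff.2 hPhU)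
    (by rw [hSP, ← cplx_mul, ← cplx_mul]) (by rw [hSA, ← cplx_mul, ← cplx_mul])
    (by rw [hSB, ← cplx_mul]) (by rw [hCP, ← cplx_mul]) hreg
  have hU₁ : IsUnit E₁ := isUnit_cplx_iff.1 hU
  refine ⟨⟨hU₁, fun z hz => ?_⟩, ?_⟩
  · by_contra hre
    refine not_mem_spectrum_iff.2 ?_ hz
    -- Stability is inherited from A': the pencil zE₁ - A₁ is invertible wherever zI - A' is.
    have h1 := hstab z (hA'.isUnit (not_lt.1 hre))
    have h2 : z • (1 : Matrix (Fin r) (Fin r) ℂ) - cplx (E₁⁻¹ * A₁)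
        = (cplx E₁)⁻¹ * (z • cplx E₁ - cplx A₁) := by
      rw [Matrix.mul_sub, Matrix.mul_smul,
        Matrix.nonsing_inv_mul _ ((Matrix.isUnit_iff_isUnit_det _).1 hU), cplx_mul, cplx_inv]
    rw [h2]
    exact ((Matrix.isUnit_nonsing_inv_iff).2 hU).mul h1
  · have h1 : transfer E₁ A₁ B₁ C₁ = transfer 1 A' B' C' := by
      funext s
      rw [transfer_one, ← htr s, transfer]
    rw [HasTransfer, h1]
    exact hy
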